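/- Let $X$ be a compact metric space, $Y$ a compact Hausdorff space and $p : Y \to X$ a branched covering, that is, a continuous surjection such that (i) every $x \in X$ has finitely many pre-images $y_1, \dots, y_m$ and an open neighbourhood $U$ with $p^{-1}(U) = V_1 \sqcup \dots \sqcup V_m$, where $V_k$ is an open neighbourhood of $y_k$, such that for all $k = 1, \dots, m$ and $j = 0, 1, 2, \dots$ the set $\{z \in U : \#(p^{-1}(z) \cap V_k) \le j\}$ is closed in $\{z \in U : \#(p^{-1}(z) \cap V_k) \le j+1\}$; (ii) the cardinalities $\# p^{-1}(x)$ are uniformly bounded over $x \in X$. Regard $C(Y)$ (continuous complex-valued functions) as a $C(X)$-module by $(f\xi)(y) = f(y)\,\xi(p(y))$. Then there is a function $\mu : Y \to (0,1]$ with $\sum_{p(y)=x} \mu(y) = 1$ for every $x \in X$ such that $$\langle f, g\rangle(x) = \sum_{p(y)=x} \mu(y)\,\overline{f(y)}\,g(y)$$ is a $C(X)$-valued inner product which makes $C(Y)$ a (complete) Hilbert $C(X)$-module whose norm $\|\langle f,f\rangle\|^{1/2}$ is equivalent to the uniform norm of $C(Y)$. Moreover, for this inner product, and in fact for every $C(X)$-valued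 inner product that makes $C(Y)$ a Hilbert $C(X)$-module with norm equivalent to the uniform norm, the Hilbert $C(X)$-module $M = C(Y)$ is $C(X)$-reflexive: the canonical map $M \to M''$, $x \mapsto \dot x$, $\dot x(f) = f(x)^*$ for $f \in M'$, is an (isometric) isomorphism of $C(X)$-modules. Here the dual $M'$ of a normed $C(X)$-module $M$ is the module of all bounded $C(X)$-linear maps $M \to C(X)$, with the operator norm and the action $(f \cdot a)(x) = a^* f(x)$, and $M'' = (M')'$. -/

import Mathlib

open scoped ComplexOrder

/-! ### Branched coverings -/

/-- `U` is a regular neighbourhood of `x` for `p : Y → X`: the point `x` has finitely many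
pre-images `y`, and `p ⁻¹' U` is the disjoint union of neighbourhoods `V y` of these
pre-images. -/
structure IsRegularNeighborhood {X Y : Type*} [TopologicalSpace X] [TopologicalSpace Y]
    (p : Y → X) (x : X) (U : Set X) (V : p ⁻¹' {x} → Set Y) : Prop where
  finite_fiber : (p ⁻¹' {x}).Finite
  isOpen_base : IsOpen U
  mem_base : x ∈ U
  isOpen_sheet : ∀ y, IsOpen (V y)
  mem_sheet : ∀ y, y.1 ∈ V y
  disjoint_sheets : Pairwise fun y y' => Disjoint (V y) (V y')
  preimage_eq : p ⁻¹' U = ⋃ y, V y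

/-- The set of the points `z` of `U` that have at most `j` pre-images in `W`. -/
def localStratum {X Y : Type*} (p : Y → X) (U : Set X) (W : Set Y) (j : ℕ) : Set X :=
  {z ∈ U | (p ⁻¹' {z} ∩ W).encard ≤ (j : ℕ∞)}

/-- Branched coverings of compact Hausdorff spaces. -/
structure IsBranchedCovering {X Y : Type*} [TopologicalSpace X] [TopologicalSpace Y]
    (p : Y → X) : Prop where
  compact_base : CompactSpace X
  t2_base : T2Space X
  compact_total : CompactSpace Y
  t2_total : T2Space Y
  continuous : Continuous p
  surjective : Function.Surjective p
  /-- Every point has a regular neighbourhood such that, for each sheet `V y`, the set of the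
  points with at most `j` pre-images in `V y` is closed in the set of those with at most `j + 1`
  pre-images in `V y`. -/
  closed_strata : ∀ x : X, ∃ (U : Set X) (V : p ⁻¹' {x} → Set Y),
    IsRegularNeighborhood p x U V ∧
      ∀ (y : p ⁻¹' {x}) (j : ℕ),
        IsClosed {z : localStratum p U (V y) (j + 1) | z.1 ∈ localStratum p U (V y) j}
  bounded_fibers : ∃ N : ℕ, ∀ x : X, (p ⁻¹' {x}).encard ≤ (N : ℕ∞)

/-! ### Dual modules and reflexivity, over a commutative unital C⋆-algebra -/

section Dual

/-- The `A`-dual module `M'` of a normed `A`-module `M`: all bounded `A`-linear maps from `M`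
to `A`, with the operator norm. -/
def ModuleDual (A M : Type*) [CommCStarAlgebra A] [NormedAddCommGroup M] [Module A M] : Type _ :=
  ({ carrier := {f | ∀ (a : A) (m : M), f (a • m) = a * f m}
     add_mem' := fun hf hg a m => by
       rw [NormedAddGroupHom.add_apply, NormedAddGroupHom.add_apply, hf a m, hg a m, mul_add]
     zero_mem' := fun a m => by simp
     neg_mem' := fun hf a m => by
       rw [NormedAddGroupHom.neg_apply, NormedAddGroupHom.neg_apply, hf a m, mul_neg] } :
    AddSubgroup (NormedAddGroupHom M A))

variable {A M : Type*} [CommCStarAlgebra A] [NormedAddCommGroup M] [Module A M]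

noncomputable instance : NormedAddCommGroup (ModuleDual A M) :=
  inferInstanceAs (NormedAddCommGroup (AddSubgroup.mk _ _))

namespace ModuleDual

instance : FunLike (ModuleDual A M) M A where
  coe f := f.1
  coe_injective f g h := Subtype.ext (DFunLike.coe_injective h)

@[ext] theorem ext {f g : ModuleDual A M} (h : ∀ m, f m = g m) : f = g :=
  DFunLike.ext _ _ h

/-- Constructor from an additive, `A`-homogeneous, bounded map. -/
noncomputable def mk (f : M → A) (hadd : ∀ m n, f (m + n) = f m + f n)
    (hsmul : ∀ (a : A) m, f (a • m) = a * f m) (C : ℝ) (hC : ∀ m, ‖f m‖ ≤ C * ‖m‖) :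
    ModuleDual A M :=
  ⟨(AddMonoidHom.mk' f hadd).mkNormedAddGroupHom C hC, hsmul⟩

@[simp] theorem mk_apply (f : M → A) (hadd : ∀ m n, f (m + n) = f m + f n)
    (hsmul : ∀ (a : A) m, f (a • m) = a * f m) (C : ℝ) (hC : ∀ m, ‖f m‖ ≤ C * ‖m‖) (m : M) :
    mk f hadd hsmul C hC m = f m := rfl

@[simp] theorem add_apply (f g : ModuleDual A M) (m : M) : (f + g) m = f m + g m := rfl

@[simp] theorem zero_apply (m : M) : (0 : ModuleDual A M) m = 0 := rfl

theorem map_add (f : ModuleDual A M) (m n : M) : f (m + n) = f m + f n :=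
  _root_.map_add f.1 m n

theorem map_smul (f : ModuleDual A M) (a : A) (m : M) : f (a • m) = a * f m := f.2 a m

theorem norm_eq (f : ModuleDual A M) :
    ‖f‖ = sInf {c : ℝ | 0 ≤ c ∧ ∀ m, ‖f m‖ ≤ c * ‖m‖} := rfl

theorem norm_apply_le (f : ModuleDual A M) (m : M) : ‖f m‖ ≤ ‖f‖ * ‖m‖ := f.1.le_opNorm m

/-- The action of `A` on `M'` is `(a • f) m = a⋆ f m`, as usual for duals of Hilbert modules
(so that `x ↦ ⟨x, ·⟩` is `A`-linear). -/
noncomputable instance : SMul A (ModuleDual A M) where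
  smul a f := mk (fun m => star a * f m)
    (fun m n => by rw [map_add, mul_add])
    (fun b m => by rw [map_smul, mul_left_comm])
    (‖a‖ * ‖f‖)
    (fun m => by
      calc ‖star a * f m‖ ≤ ‖star a‖ * ‖f m‖ := norm_mul_le _ _
        _ ≤ ‖a‖ * (‖f‖ * ‖m‖) := by
          rw [norm_star]
          exact mul_le_mul_of_nonneg_left (norm_apply_le f m) (norm_nonneg a)
        _ = ‖a‖ * ‖f‖ * ‖m‖ := by ring)

@[simp] theorem smul_apply (a : A) (f : ModuleDual A M) (m : M) :
    (a • f) m = star a * f m := rfl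

noncomputable instance : Module A (ModuleDual A M) where
  one_smul f := by ext m; simp
  mul_smul a b f := by ext m; simp [mul_assoc]
  smul_zero a := by ext m; simp
  smul_add a f g := by ext m; simp [mul_add]
  add_smul a b f := by ext m; simp [add_mul]
  zero_smul f := by ext m; simp

end ModuleDual

variable (A M)

/-- The canonical `A`-linear map `M → M''`, `ẋ(f) = f(x)⋆`. -/
noncomputable def toBidual : M →ₗ[A] ModuleDual A (ModuleDual A M) where
  toFun x := ModuleDual.mk (fun f => star (f x))
    (fun f g => by simp)
    (fun a f => by simp)
    ‖x‖
    (fun f => by rw [norm_star, mul_comm]; exact f.norm_apply_le x)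
  map_add' x y := by
    apply ModuleDual.ext; intro f
    simp [ModuleDual.map_add]
  map_smul' a x := by
    apply ModuleDual.ext; intro f
    simp [ModuleDual.map_smul]

/-- `M` is `A`-reflexive: the canonical map `M → M''` is an (isometric) isomorphism of
`A`-modules. -/
def IsReflexiveModule : Prop :=
  Function.Bijective (toBidual A M) ∧ Isometry (toBidual A M)

end Dual

/-! ### `C(Y)` as a module over `C(X)` -/

/-- The vector space `C(Y)`, regarded as a `C(X)`-module through `p : Y → X`. It carries no norm
of its own. -/
def PullbackModule {X Y : Type*} [TopologicalSpace X] [TopologicalSpace Y] (_p : C(Y, X)) :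
    Type _ :=
  C(Y, ℂ)

section Pullback

variable {X Y : Type*} [TopologicalSpace X] [TopologicalSpace Y] (p : C(Y, X))

noncomputable instance : AddCommGroup (PullbackModule p) :=
  inferInstanceAs (AddCommGroup C(Y, ℂ))

noncomputable instance : Module ℂ (PullbackModule p) :=
  inferInstanceAs (Module ℂ C(Y, ℂ))

/-- The action `(ξ • f) y = ξ (p y) * f y`. -/
noncomputable instance : Module C(X, ℂ) (PullbackModule p) :=
  Module.compHom C(Y, ℂ) (ContinuousMap.compRightAlgHom ℂ ℂ p).toRingHom

/-- A function on `Y` as an element of the module. -/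
noncomputable def PullbackModule.of : C(Y, ℂ) ≃ₗ[ℂ] PullbackModule p := LinearEquiv.refl ℂ C(Y, ℂ)

theorem PullbackModule.smul_of (ξ : C(X, ℂ)) (f : C(Y, ℂ)) :
    ξ • PullbackModule.of p f = PullbackModule.of p (ξ.comp p * f) := rfl

end Pullback

/-- A `C(X)`-valued inner product that turns the `C(X)`-module `C(Y)` into a (complete) Hilbert
`C(X)`-module. -/
structure HilbertProduct {X Y : Type*} [TopologicalSpace X] [CompactSpace X]
    [TopologicalSpace Y] (p : C(Y, X)) where
  /-- The Hilbert norm; `cstar` contains the identity `‖f‖ = ‖⟨f, f⟩‖ ^ (1 / 2)`. -/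
  norm : Norm (PullbackModule p)
  cstar : CStarModule C(X, ℂ) (PullbackModule p)
  complete : @CompleteSpace (PullbackModule p)
    (CStarModule.normedAddCommGroup C(X, ℂ)).toUniformSpace

namespace HilbertProduct

variable {X Y : Type*} [TopologicalSpace X] [CompactSpace X] [TopologicalSpace Y] {p : C(Y, X)}

/-- The value `⟨f, g⟩`. -/
noncomputable def inner (B : HilbertProduct p) (f g : C(Y, ℂ)) : C(X, ℂ) :=
  B.cstar.inner (PullbackModule.of p f) (PullbackModule.of p g)

/-- The Hilbert `C(X)`-module `C(Y)` with the inner product `B`. -/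
def HilbertModule (_B : HilbertProduct p) : Type _ := PullbackModule p

variable (B : HilbertProduct p)

noncomputable instance : NormedAddCommGroup B.HilbertModule :=
  @CStarModule.normedAddCommGroup C(X, ℂ) (PullbackModule p) _ _ _ _ _ B.norm B.cstar _

noncomputable instance : Module ℂ B.HilbertModule :=
  inferInstanceAs (Module ℂ (PullbackModule p))

noncomputable instance : Module C(X, ℂ) B.HilbertModule :=
  inferInstanceAs (Module C(X, ℂ) (PullbackModule p))

noncomputable instance : CStarModule C(X, ℂ) B.HilbertModule := B.cstar

instance : CompleteSpace B.HilbertModule := B.complete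

/-- A function on `Y` as an element of the Hilbert module. -/
noncomputable def toModule : C(Y, ℂ) ≃ₗ[ℂ] B.HilbertModule := PullbackModule.of p

theorem smul_toModule (ξ : C(X, ℂ)) (f : C(Y, ℂ)) :
    ξ • B.toModule f = B.toModule (ξ.comp p * f) := rfl

theorem inner_toModule (f g : C(Y, ℂ)) :
    Inner.inner C(X, ℂ) (B.toModule f) (B.toModule g) = B.inner f g := rfl

theorem norm_toModule (f : C(Y, ℂ)) : ‖B.toModule f‖ = √‖B.inner f f‖ :=
  B.cstar.norm_eq_sqrt_norm_inner_self _

/-- The Hilbert norm `‖⟨f, f⟩‖ ^ (1 / 2)` is equivalent to the uniform norm of `C(Y)`. -/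
def IsNormEquivalent [CompactSpace Y] (B : HilbertProduct p) : Prop :=
  ∃ c C : ℝ, 0 < c ∧ 0 < C ∧
    ∀ f : C(Y, ℂ), c * ‖f‖ ≤ √‖B.inner f f‖ ∧ √‖B.inner f f‖ ≤ C * ‖f‖

/-- Over each `x`, the inner product is a weighted average over the fibre of `x`, with strictly
positive weights: `⟨f, g⟩(x) = ∑ μ(y) * conj (f y) * g y`, the sum over `y` with `p y = x`. -/
def IsFiberAverage (B : HilbertProduct p) : Prop :=
  ∃ μ : Y → ℝ, (∀ y, 0 < μ y) ∧ (∀ x, ∑ᶠ y ∈ p ⁻¹' {x}, μ y = 1) ∧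
    ∀ (f g : C(Y, ℂ)) (x : X),
      B.inner f g x = ∑ᶠ y ∈ p ⁻¹' {x}, (μ y : ℂ) * (starRingEnd ℂ (f y) * g y)

end HilbertProduct

/-! The closedness of the strata and the bound on the fibres make `p` an open map
(`IsBranchedCovering.isOpenMap`). So `p` is open and closed with boundedly finite fibres, and the
rest of the argument uses only this.

Weights. The uniform weights on the fibres need not give continuous averages, since points of a
fibre may merge. Instead, unit mass on a fibre is halved successively along the sets `{a j + u >
0}`, for a sequence `a` whose sets separate the points of every fibre for every `u`. If the fibre of
`x` avoids the boundaries of these sets, a nearby fibre falls into clusters around its points, and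
each cluster receives the mass of its centre; so the averages are continuous at `x` for this `u`.
For a given `x` only countably many `u` are bad, hence integration over `u` in `[0, 1]` and
dominated convergence give averages continuous everywhere (`continuous_sum_meanWeight`). A point of
an `n`-point fibre keeps weight at least `2 ^ (-n)`, which yields equivalence of norms and
completeness.

Reflexivity. The canonical map is isometric because `⟨x, ·⟩` norms `x`. For surjectivity,
equivalence of norms replaces the dual of the Hilbert module by the bounded `C(X)`-linear maps for
the uniform norm, so every inner product is treated at once: a `C(X)`-linear map `Θ` on these
functionals has to be evaluation at some `m` in `C(Y)`. Over the dense set of points where the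
number of pre-images is locally constant, `p` has local sections and `Θ` is evaluation at a function
`h` (`exists_eval_at`). It remains to extend `h` continuously. A gliding hump argument shows that
`h` varies little between nearby points of one fibre (`exists_nhds_norm_sub_lt`). Then `h y` is
close to a localized weighted average of `h` over its fibre, which is the value of `Θ` at one
functional divided by a nonzero continuous function; thus `h` has limits (`exists_tendsto`), and
density finishes the proof (`exists_eval`). -/

open Filter Topology MeasureTheory

/-! ### Open maps with finite fibres -/

section FiniteFibers

variable {X Y : Type*} [TopologicalSpace X] [TopologicalSpace Y]

/-- In a fibre of a closed map, a point that is separated from the rest of the fibre has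
a neighbourhood basis of the form `p ⁻¹' U ∩ V` with `V` fixed. -/
theorem IsClosedMap.nhds_eq_comap_inf_principal {p : Y → X} (hc : IsClosedMap p)
    (hp : Continuous p) {y : Y} {V V' : Set Y} (hV : IsOpen V) (hV' : IsOpen V')
    (hy : y ∈ V) (hVV' : Disjoint V V') (hfib : p ⁻¹' {p y} ⊆ {y} ∪ V') :
    𝓝 y = comap p (𝓝 (p y)) ⊓ 𝓟 V := by
  apply le_antisymm
  · exact le_inf (hp.tendsto y).le_comap (le_principal_iff.2 (hV.mem_nhds hy))
  · intro W hW
    have h : ∀ᶠ x in 𝓝 (p y), ∀ z, p z = x → z ∈ interior W ∪ V' := by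
      have := hc.eventually_nhds_fiber (p := fun z => z ∈ interior W ∪ V') (p y) (by
        intro z hz
        rcases hfib hz with rfl | h
        · exact (isOpen_interior.union hV').mem_nhds
            (Or.inl (mem_interior_iff_mem_nhds.2 hW))
        · exact (isOpen_interior.union hV').mem_nhds (Or.inr h))
      filter_upwards [this] with x hx z hz using hx z hz
    rw [mem_inf_principal]
    refine ⟨_, h, fun z hz hzV => ?_⟩
    rcases hz z rfl with h | h
    · exact interior_subset h
    · exact (Set.disjoint_left.1 hVV' hzV h).elim

theorem Set.Finite.exists_isOpen_disjoint [T2Space Y] {s : Set Y} (hs : s.Finite) (y : Y) :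
    ∃ V V' : Set Y, IsOpen V ∧ IsOpen V' ∧ y ∈ V ∧ Disjoint V V' ∧ s ⊆ {y} ∪ V' := by
  have h1 : IsCompact (s \ {y}) := (hs.subset Set.sdiff_subset).isCompact
  obtain ⟨V, V', hV, hV', h, h', hd⟩ := SeparatedNhds.of_isCompact_isCompact
    (isCompact_singleton (x := y)) h1 (Set.disjoint_left.2 fun z hz hz' => hz'.2 hz)
  refine ⟨V, V', hV, hV', h rfl, hd, fun z hz => ?_⟩
  by_cases hzy : z = y
  · exact Or.inl hzy
  · exact Or.inr (h' ⟨hz, hzy⟩)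

/-- Each stratum of a sheet is closed in the next one, and the bound on the fibres makes the `N`-th
stratum all of `U`; hence the set `Z 0` of points of `U` missed by the sheet is closed in `U`. It
does not contain `p y`, so all points near `p y` have a pre-image in the sheet of `y`, and this
pre-image is near `y` because `p` is closed. -/
theorem IsBranchedCovering.isOpenMap {p : Y → X} (hp : IsBranchedCovering p) : IsOpenMap p := by
  have := hp.compact_total
  have := hp.t2_base
  have hc : IsClosedMap p := hp.continuous.isClosedMap
  rw [isOpenMap_iff_nhds_le]
  intro y W hW
  obtain ⟨U, V, hreg, hstr⟩ := hp.closed_strata (p y)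
  obtain ⟨N, hN⟩ := hp.bounded_fibers
  let y₀ : p ⁻¹' {p y} := ⟨y, rfl⟩
  set Z := fun j => localStratum p U (V y₀) j with hZ
  have hmono : ∀ j, Z 0 ⊆ Z j := fun j z hz => ⟨hz.1, hz.2.trans (by simp)⟩
  have hstep : ∀ j, closure (Z j) ∩ Z (j + 1) ⊆ Z j := by
    intro j z hz
    have hcl := hstr y₀ j
    obtain ⟨T, hT, hTe⟩ := isClosed_induced_iff.1 hcl
    have hsub : Z j ⊆ T := by
      intro w hw
      have hw' : w ∈ Z (j + 1) := ⟨hw.1, hw.2.trans (by exact_mod_cast Nat.le_succ j)⟩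
      have : (⟨w, hw'⟩ : localStratum p U (V y₀) (j + 1)) ∈ Subtype.val ⁻¹' T := by
        rw [hTe]; exact hw
      exact this
    have : (⟨z, hz.2⟩ : localStratum p U (V y₀) (j + 1)) ∈ Subtype.val ⁻¹' T :=
      closure_minimal hsub hT hz.1
    rw [hTe] at this
    exact this
  have hclosed : ∀ j, closure (Z 0) ∩ Z j ⊆ Z 0 := by
    intro j
    induction j with
    | zero => exact fun z hz => hz.2
    | succ j ih => exact fun z hz => ih ⟨hz.1, hstep j ⟨closure_mono (hmono j) hz.1, hz.2⟩⟩
  have hx : p y ∉ closure (Z 0) := by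
    intro h
    have h0 := hclosed N ⟨h, hreg.mem_base, (Set.encard_le_encard Set.inter_subset_left).trans
      (hN _)⟩
    have h1 : (p ⁻¹' {p y} ∩ V y₀).encard = 0 := by simpa using h0.2
    rw [Set.encard_eq_zero] at h1
    exact Set.notMem_empty y (h1 ▸ ⟨rfl, hreg.mem_sheet y₀⟩)
  have hbasis := hc.nhds_eq_comap_inf_principal hp.continuous (hreg.isOpen_sheet y₀)
    (isOpen_iUnion fun y' : {y' // y' ≠ y₀} => hreg.isOpen_sheet y'.1) (hreg.mem_sheet y₀)
    (Set.disjoint_iUnion_right.2 fun y' => hreg.disjoint_sheets y'.2.symm)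
    (by
      intro z hz
      by_cases hzy : z = y
      · exact Or.inl hzy
      · exact Or.inr (Set.mem_iUnion.2 ⟨⟨⟨z, hz⟩, fun h => hzy (congrArg Subtype.val h)⟩,
          hreg.mem_sheet ⟨z, hz⟩⟩))
  rw [mem_map] at hW
  change _ ∈ 𝓝 y at hW
  rw [hbasis, mem_inf_principal] at hW
  obtain ⟨O, hO, hOW⟩ := hW
  filter_upwards [hO, hreg.isOpen_base.mem_nhds hreg.mem_base,
    isClosed_closure.isOpen_compl.mem_nhds hx] with z hzO hzU hz
  have hne : (p ⁻¹' {z} ∩ V y₀).Nonempty := by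
    rw [Set.nonempty_iff_ne_empty]
    intro he
    exact hz (subset_closure ⟨hzU, by rw [he]; simp⟩)
  obtain ⟨w, hw, hwV⟩ := hne
  have hwz : p w = z := hw
  have := hOW (show w ∈ p ⁻¹' O by rw [Set.mem_preimage, hwz]; exact hzO) hwV
  rwa [Set.mem_preimage, hwz] at this

/-- The fibres of an open map with finite fibres are lower semicontinuous: disjoint neighbourhoods
of the points of a fibre are met by all nearby fibres. -/
theorem IsOpenMap.eventually_forall_fiber {p : Y → X} (ho : IsOpenMap p) {x : X}
    (hfin : (p ⁻¹' {x}).Finite) {V : Y → Set Y} (hV : ∀ y ∈ p ⁻¹' {x}, V y ∈ 𝓝 y) :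
    ∀ᶠ z in 𝓝 x, ∀ y ∈ p ⁻¹' {x}, ∃ w ∈ V y, p w = z := by
  rw [eventually_all_finite hfin]
  intro y hy
  have hy' : p y = x := hy
  have := ho.image_mem_nhds (hV y hy)
  rw [hy'] at this
  filter_upwards [this] with z hz using hz

theorem IsOpenMap.eventually_ncard_le {p : Y → X} (ho : IsOpenMap p) [T2Space Y]
    (hfin : ∀ x, (p ⁻¹' {x}).Finite) (x : X) :
    ∀ᶠ z in 𝓝 x, (p ⁻¹' {x}).ncard ≤ (p ⁻¹' {z}).ncard := by
  obtain ⟨V, hV, hd⟩ := (hfin x).t2_separation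
  filter_upwards [ho.eventually_forall_fiber (hfin x) fun y _ => (hV y).2.mem_nhds (hV y).1]
    with z hz
  choose! s hs hps using hz
  refine Set.ncard_le_ncard_of_injOn s (fun y hy => hps y hy) (fun y hy y' hy' h => ?_) (hfin z)
  by_contra hne
  exact Set.disjoint_left.1 (hd hy hy' hne) (hs y hy) (h ▸ hs y' hy')

/-- The points over which the number of pre-images is locally constant are dense. -/
theorem IsOpenMap.dense_locally_constant_ncard {p : Y → X} (ho : IsOpenMap p) [T2Space Y]
    (hfin : ∀ x, (p ⁻¹' {x}).Finite) {N : ℕ} (hN : ∀ x, (p ⁻¹' {x}).ncard ≤ N) :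
    Dense {x | ∀ᶠ z in 𝓝 x, (p ⁻¹' {z}).ncard = (p ⁻¹' {x}).ncard} := by
  rw [dense_iff_inter_open]
  intro O hO ⟨x₀, hx₀⟩
  have hbdd : BddAbove ((fun x => (p ⁻¹' {x}).ncard) '' O) :=
    ⟨N, by rintro _ ⟨x, -, rfl⟩; exact hN x⟩
  -- At a point of `O` with the maximal number of pre-images, lower semicontinuity prevents the
  -- number from dropping nearby and maximality prevents it from growing.
  obtain ⟨x, hx, hmax⟩ := Nat.sSup_mem (⟨_, x₀, hx₀, rfl⟩ :
    ((fun x => (p ⁻¹' {x}).ncard) '' O).Nonempty) hbdd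
  refine ⟨x, hx, ?_⟩
  filter_upwards [hO.mem_nhds hx, ho.eventually_ncard_le hfin x] with z hz hle
  exact le_antisymm ((le_csSup hbdd ⟨z, hz, rfl⟩).trans_eq hmax.symm) hle

/-- Local triviality of an open map near a point where the number of pre-images is locally
constant. -/
theorem IsOpenMap.exists_local_sections {p : Y → X} (ho : IsOpenMap p) [T2Space Y]
    (hfin : ∀ x, (p ⁻¹' {x}).Finite) {x : X}
    (hx : ∀ᶠ z in 𝓝 x, (p ⁻¹' {z}).ncard = (p ⁻¹' {x}).ncard) :
    ∃ (U : Set X) (V : Y → Set Y) (s : Y → X → Y), IsOpen U ∧ x ∈ U ∧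
      (p ⁻¹' {x}).PairwiseDisjoint V ∧ (∀ y, IsOpen (V y)) ∧
      (∀ y ∈ p ⁻¹' {x}, ContinuousOn (s y) U ∧ s y x = y ∧
        ∀ z ∈ U, p (s y z) = z ∧ s y z ∈ V y) ∧
      ∀ w, p w ∈ U → ∃ y ∈ p ⁻¹' {x}, s y (p w) = w := by
  obtain ⟨V, hV, hd⟩ := (hfin x).t2_separation
  have hev := (ho.eventually_forall_fiber (hfin x) fun y _ => (hV y).2.mem_nhds (hV y).1).and hx
  obtain ⟨U, hU, hUo, hxU⟩ := eventually_nhds_iff.1 hev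
  have hex : ∀ y z, ∃ w, y ∈ p ⁻¹' {x} → z ∈ U → w ∈ V y ∧ p w = z := by
    intro y z
    by_cases h : y ∈ p ⁻¹' {x} ∧ z ∈ U
    · obtain ⟨w, hw⟩ := (hU z h.2).1 y h.1
      exact ⟨w, fun _ _ => hw⟩
    · exact ⟨y, fun h1 h2 => (h ⟨h1, h2⟩).elim⟩
  choose s hs using hex
  -- The chosen points over `p w` lie in disjoint sets, and there are as many of them as pre-images
  -- of `p w`; so they exhaust the fibre.
  have hsurj : ∀ w, p w ∈ U → ∃ y ∈ p ⁻¹' {x}, s y (p w) = w := by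
    intro w hw
    have hinj : Set.InjOn (fun y => s y (p w)) (p ⁻¹' {x}) := by
      intro y hy y' hy' h
      by_contra hne
      refine Set.disjoint_left.1 (hd hy hy' hne) (hs y _ hy hw).1 ?_
      have h' : s y (p w) = s y' (p w) := h
      rw [h']; exact (hs y' _ hy' hw).1
    have hsub : (fun y => s y (p w)) '' (p ⁻¹' {x}) ⊆ p ⁻¹' {p w} := by
      rintro _ ⟨y, hy, rfl⟩
      exact (hs y _ hy hw).2
    have heq := Set.eq_of_subset_of_ncard_le hsub
      (by rw [hinj.ncard_image, (hU _ hw).2]) (hfin _)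
    have : w ∈ (fun y => s y (p w)) '' (p ⁻¹' {x}) := by rw [heq]; rfl
    exact this
  have huniq : ∀ y ∈ p ⁻¹' {x}, ∀ w ∈ V y, p w ∈ U → s y (p w) = w := by
    intro y hy w hwV hw
    obtain ⟨y', hy', h⟩ := hsurj w hw
    by_cases hne : y = y'
    · rw [hne, h]
    · exact (Set.disjoint_left.1 (hd hy hy' hne) hwV (h ▸ (hs y' _ hy' hw).1)).elim
  refine ⟨U, V, s, hUo, hxU, hd, fun y => (hV y).2, fun y hy => ⟨?_, ?_, fun z hz =>
    ⟨(hs y z hy hz).2, (hs y z hy hz).1⟩⟩, hsurj⟩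
  · intro z hz
    have hpz := (hs y z hy hz).2
    refine ContinuousAt.continuousWithinAt ?_
    -- Continuity of the section comes from openness: the image of `W ∩ V y` is a neighbourhood of
    -- `z`, and over it the only candidate for the value of the section lies in `W`.
    intro W hW
    have h1 := ho.image_mem_nhds (inter_mem hW ((hV y).2.mem_nhds (hs y z hy hz).1))
    rw [hpz] at h1
    rw [mem_map]
    filter_upwards [h1, hUo.mem_nhds hz] with z' hz' hzU'
    obtain ⟨w, hw, rfl⟩ := hz'
    rw [Set.mem_preimage, huniq y hy w hw.2 hzU']
    exact hw.1
  · have hy' : p y = x := hy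
    have := huniq y hy y (hV y).1 (hy'.symm ▸ hxU)
    rwa [hy'] at this

end FiniteFibers

/-! ### Weights on finite sets from sequential binary splitting -/

section SplitWeight

open scoped Classical in
/-- The points of `F` on the same side of `c` as `y`. -/
noncomputable def splitCell {Y : Type*} (c : Set Y) (F : Finset Y) (y : Y) : Finset Y :=
  F.filter fun z => z ∈ c ↔ y ∈ c

open scoped Classical in
/-- Unit mass placed on `F` is split by the members of a list of sets, one after another: whenever
a set separates some of the points that are still together, both parts get half of the mass.
In the end the mass is spread evenly. -/
noncomputable def splitWeight {Y : Type*} : List (Set Y) → Finset Y → Y → ℝ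
  | [], F, _ => (F.card : ℝ)⁻¹
  | c :: L, F, y =>
    (if splitCell c F y = F then 1 else 1 / 2) * splitWeight L (splitCell c F y) y

variable {Y : Type*}

theorem mem_splitCell {c : Set Y} {F : Finset Y} {y z : Y} :
    z ∈ splitCell c F y ↔ z ∈ F ∧ (z ∈ c ↔ y ∈ c) := by
  classical
  simp [splitCell]

theorem splitCell_subset {c : Set Y} {F : Finset Y} {y : Y} : splitCell c F y ⊆ F :=
  fun _ hz => (mem_splitCell.1 hz).1

theorem splitCell_congr {c : Set Y} {F : Finset Y} {y z : Y} (h : z ∈ c ↔ y ∈ c) :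
    splitCell c F z = splitCell c F y := by
  ext w; simp [mem_splitCell, h]

theorem self_mem_splitCell {c : Set Y} {F : Finset Y} {y : Y} (hy : y ∈ F) :
    y ∈ splitCell c F y := mem_splitCell.2 ⟨hy, Iff.rfl⟩

theorem splitWeight_nonneg (L : List (Set Y)) (F : Finset Y) (y : Y) : 0 ≤ splitWeight L F y := by
  induction L generalizing F with
  | nil => simp [splitWeight]
  | cons c L ih =>
    rw [splitWeight]
    exact mul_nonneg (by split_ifs <;> norm_num) (ih _)

/-- Every halving removes at least one point from the cell of `y`, so the factor `1 / 2` is paid for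
by the drop in cardinality. The bound is therefore independent of the length of `L`. -/
theorem le_splitWeight (L : List (Set Y)) {F : Finset Y} {y : Y} (hy : y ∈ F) :
    (1 / 2 : ℝ) ^ F.card ≤ splitWeight L F y := by
  induction L generalizing F with
  | nil =>
    rw [splitWeight, one_div, inv_pow]
    have hpos : (0 : ℝ) < F.card := by exact_mod_cast Finset.card_pos.2 ⟨y, hy⟩
    exact inv_anti₀ hpos (by exact_mod_cast Nat.lt_two_pow_self.le)
  | cons c L ih =>
    rw [splitWeight]
    have h := ih (self_mem_splitCell (c := c) hy)
    split_ifs with hF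
    · rw [hF] at h ⊢
      simpa using h
    · have hlt : (splitCell c F y).card < F.card :=
        Finset.card_lt_card (splitCell_subset.ssubset_of_ne hF)
      calc (1 / 2 : ℝ) ^ F.card ≤ (1 / 2) ^ ((splitCell c F y).card + 1) :=
            pow_le_pow_of_le_one (by norm_num) (by norm_num) hlt
        _ = 1 / 2 * (1 / 2) ^ (splitCell c F y).card := by rw [pow_succ']
        _ ≤ _ := by gcongr

theorem sum_splitWeight (L : List (Set Y)) {F : Finset Y} (hF : F.Nonempty) :
    ∑ y ∈ F, splitWeight L F y = 1 := by
  classical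
  induction L generalizing F with
  | nil =>
    have : (F.card : ℝ) ≠ 0 := by exact_mod_cast hF.card_pos.ne'
    simp [splitWeight, this]
  | cons c L ih =>
    by_cases h : ∀ y ∈ F, splitCell c F y = F
    · rw [← ih hF]
      refine Finset.sum_congr rfl fun y hy => ?_
      rw [splitWeight, h y hy]
      simp
    · push Not at h
      obtain ⟨y, hy, hne⟩ := h
      have hy' : ∃ w ∈ F, ¬ (w ∈ c ↔ y ∈ c) := by
        by_contra hcon
        push Not at hcon
        exact hne (Finset.Subset.antisymm splitCell_subset
          fun z hz => mem_splitCell.2 ⟨hz, hcon z hz⟩)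
      obtain ⟨w, hw, hwy⟩ := hy'
      -- A proper cell carries half of the mass; the cells of `y` and `w` are the two complementary
      -- ones.
      have key : ∀ v ∈ F, splitCell c F v ≠ F →
          ∑ z ∈ splitCell c F v, splitWeight (c :: L) F z = 1 / 2 := by
        intro v hv hvF
        rw [Finset.sum_congr (g := fun z => 1 / 2 * splitWeight L (splitCell c F v) z) rfl,
          ← Finset.mul_sum, ih ⟨v, self_mem_splitCell hv⟩, mul_one]
        intro z hz
        rw [splitWeight, splitCell_congr (mem_splitCell.1 hz).2, if_neg hvF]
      have hwF : splitCell c F w ≠ F := by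
        intro h
        exact hwy (mem_splitCell.1 (h.symm ▸ hy : y ∈ splitCell c F w)).2.symm
      have hunion : F = splitCell c F y ∪ splitCell c F w := by
        ext z
        simp only [Finset.mem_union, mem_splitCell]
        tauto
      have hdisj : Disjoint (splitCell c F y) (splitCell c F w) := by
        rw [Finset.disjoint_left]
        intro z hz hz'
        have := (mem_splitCell.1 hz).2
        have := (mem_splitCell.1 hz').2
        tauto
      have h2 : ∑ z ∈ splitCell c F y ∪ splitCell c F w, splitWeight (c :: L) F z = 1 := by
        rw [Finset.sum_union hdisj, key y hy hne, key w hw hwF]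
        norm_num
      rwa [← hunion] at h2

open scoped Classical in
/-- If `π` maps `F` onto `F₀`, respects the sets of the list `L`, and `L` separates the points
of `F₀`, then the weights on `F₀` are the image of the weights on `F`, even when the splitting of
`F` is continued. -/
theorem sum_splitWeight_append (L L' : List (Set Y)) {F F₀ : Finset Y} {π : Y → Y}
    (hπ : ∀ z ∈ F, π z ∈ F₀) (hsurj : ∀ y ∈ F₀, ∃ z ∈ F, π z = y)
    (hcomp : ∀ c ∈ L, ∀ z ∈ F, (z ∈ c ↔ π z ∈ c))
    (hsep : ∀ y ∈ F₀, ∀ y' ∈ F₀, (∀ c ∈ L, (y ∈ c ↔ y' ∈ c)) → y = y') {y : Y} (hy : y ∈ F₀) :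
    ∑ z ∈ F with π z = y, splitWeight (L ++ L') F z = splitWeight L F₀ y := by
  induction L generalizing F F₀ with
  | nil =>
    -- With no sets left, separation forces `F₀` to be a single point, and all of the mass of `F`
    -- lies over it, however `L'` distributes it.
    have hF₀ : F₀ = {y} := by
      ext z
      rw [Finset.mem_singleton]
      exact ⟨fun hz => hsep z hz y hy (by simp), fun h => h ▸ hy⟩
    obtain ⟨z, hz, -⟩ := hsurj y hy
    have hfil : F.filter (fun z => π z = y) = F := by
      refine Finset.filter_true_of_mem fun z hz => ?_
      have := hπ z hz
      rwa [hF₀, Finset.mem_singleton] at this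
    rw [hfil, List.nil_append, sum_splitWeight L' ⟨z, hz⟩, hF₀]
    simp [splitWeight]
  | cons c L ih =>
    set G₀ := splitCell c F₀ y with hG₀
    set G := F.filter (fun z => z ∈ c ↔ y ∈ c) with hG
    have hcell : ∀ z ∈ F, π z = y → splitCell c F z = G := by
      intro z hz hzy
      have h1 := hcomp c (by simp) z hz
      rw [hzy] at h1
      rw [splitCell_congr h1]; rfl
    -- The set `c` separates points of `F` exactly when it separates points of `F₀`, so both masses
    -- are halved at the same time.
    have hGF : G = F ↔ G₀ = F₀ := by
      constructor
      · intro h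
        refine Finset.Subset.antisymm splitCell_subset fun y' hy' => mem_splitCell.2 ⟨hy', ?_⟩
        obtain ⟨z, hz, rfl⟩ := hsurj y' hy'
        rw [← hcomp c (by simp) z hz]
        exact (Finset.mem_filter.1 (h.symm ▸ hz : z ∈ G)).2
      · intro h
        refine Finset.filter_true_of_mem fun z hz => ?_
        rw [hcomp c (by simp) z hz]
        exact (mem_splitCell.1 (h.symm ▸ hπ z hz : π z ∈ G₀)).2
    have hfil : F.filter (fun z => π z = y) = G.filter (fun z => π z = y) := by
      ext z
      simp only [hG, Finset.mem_filter]
      constructor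
      · rintro ⟨hz, hzy⟩
        have h1 := hcomp c (by simp) z hz
        rw [hzy] at h1
        exact ⟨⟨hz, h1⟩, hzy⟩
      · rintro ⟨⟨hz, -⟩, hzy⟩
        exact ⟨hz, hzy⟩
    have hih := ih (F := G) (F₀ := G₀)
      (fun z hz => by
        obtain ⟨hz, hzc⟩ := Finset.mem_filter.1 hz
        exact mem_splitCell.2 ⟨hπ z hz, (hcomp c (by simp) z hz).symm.trans hzc⟩)
      (fun y' hy' => by
        obtain ⟨hy', hyc⟩ := mem_splitCell.1 hy'
        obtain ⟨z, hz, rfl⟩ := hsurj y' hy'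
        exact ⟨z, Finset.mem_filter.2 ⟨hz, (hcomp c (by simp) z hz).trans hyc⟩, rfl⟩)
      (fun c' hc' z hz => hcomp c' (by simp [hc']) z (Finset.mem_filter.1 hz).1)
      (fun y₁ h₁ y₂ h₂ h => hsep y₁ (splitCell_subset h₁) y₂ (splitCell_subset h₂) (by
        intro c' hc'
        rcases List.mem_cons.1 hc' with rfl | hc'
        · exact (mem_splitCell.1 h₁).2.trans (mem_splitCell.1 h₂).2.symm
        · exact h c' hc'))
      (self_mem_splitCell hy)
    rw [splitWeight, ← hih, hfil, Finset.mul_sum]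
    refine Finset.sum_congr rfl fun z hz => ?_
    obtain ⟨hz, hzy⟩ := Finset.mem_filter.1 (hfil ▸ hz : z ∈ F.filter _)
    rw [List.cons_append, splitWeight, hcell z hz hzy]
    congr 1
    simp only [hGF]
    rfl

/-- Once the cells are single points, further splitting has no effect. This makes the limit defining
`thresholdWeight` eventually constant. -/
theorem splitWeight_append_of_separates (L L' : List (Set Y)) {F : Finset Y}
    (hsep : ∀ y ∈ F, ∀ y' ∈ F, (∀ c ∈ L, (y ∈ c ↔ y' ∈ c)) → y = y') {y : Y} (hy : y ∈ F) :
    splitWeight (L ++ L') F y = splitWeight L F y := by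
  classical
  rw [← sum_splitWeight_append L L' (π := id) (fun z hz => hz) (fun z hz => ⟨z, hz, rfl⟩)
    (fun _ _ _ _ => Iff.rfl) hsep hy]
  simp [Finset.sum_filter, hy]

/-- A function whose averages vary little: comparison of the averages over `F` and over `F₀`. -/
theorem norm_sum_splitWeight_sub_le (L L' : List (Set Y)) {F F₀ : Finset Y} {π : Y → Y}
    (hF : F.Nonempty)
    (hπ : ∀ z ∈ F, π z ∈ F₀) (hsurj : ∀ y ∈ F₀, ∃ z ∈ F, π z = y)
    (hcomp : ∀ c ∈ L, ∀ z ∈ F, (z ∈ c ↔ π z ∈ c))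
    (hsep : ∀ y ∈ F₀, ∀ y' ∈ F₀, (∀ c ∈ L, (y ∈ c ↔ y' ∈ c)) → y = y')
    {f : Y → ℂ} {ε : ℝ} (hf : ∀ z ∈ F, ‖f z - f (π z)‖ ≤ ε) :
    ‖∑ z ∈ F, (splitWeight (L ++ L') F z : ℂ) * f z -
      ∑ y ∈ F₀, (splitWeight L F₀ y : ℂ) * f y‖ ≤ ε := by
  classical
  have h : ∑ y ∈ F₀, (splitWeight L F₀ y : ℂ) * f y =
      ∑ z ∈ F, (splitWeight (L ++ L') F z : ℂ) * f (π z) := by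
    rw [← Finset.sum_fiberwise_of_maps_to hπ]
    refine Finset.sum_congr rfl fun y hy => ?_
    rw [← sum_splitWeight_append L L' hπ hsurj hcomp hsep hy, Complex.ofReal_sum,
      Finset.sum_mul]
    refine Finset.sum_congr rfl fun z hz => ?_
    rw [(Finset.mem_filter.1 hz).2]
  rw [h, ← Finset.sum_sub_distrib]
  calc _ ≤ ∑ z ∈ F, ‖(splitWeight (L ++ L') F z : ℂ) * f z -
        (splitWeight (L ++ L') F z : ℂ) * f (π z)‖ := norm_sum_le _ _
    _ ≤ ∑ z ∈ F, splitWeight (L ++ L') F z * ε := by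
        refine Finset.sum_le_sum fun z hz => ?_
        rw [← mul_sub, norm_mul, Complex.norm_real, Real.norm_of_nonneg (splitWeight_nonneg _ _ _)]
        exact mul_le_mul_of_nonneg_left (hf z hz) (splitWeight_nonneg _ _ _)
    _ = ε := by rw [← Finset.sum_mul, sum_splitWeight _ hF, one_mul]

theorem measurable_splitWeight {Ω : Type*} [MeasurableSpace Ω] (L : List (Ω → Set Y))
    (hL : ∀ c ∈ L, ∀ z, MeasurableSet {u | z ∈ c u}) (F : Finset Y) (y : Y) :
    Measurable fun u => splitWeight (L.map fun c => c u) F y := by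
  classical
  induction L generalizing F with
  | nil => exact measurable_const
  | cons c L ih =>
    have hc := hL c (by simp)
    have ih' := ih fun c' hc' => hL c' (by simp [hc'])
    -- The cell of `y` depends on `u` but takes only finitely many values; summing over these values
    -- reduces measurability to that of the sets where each is taken.
    have h : (fun u => splitWeight ((c :: L).map fun c => c u) F y) = fun u =>
        ∑ G ∈ F.powerset, if splitCell (c u) F y = G then
          (if G = F then 1 else 1 / 2) * splitWeight (L.map fun c => c u) G y else 0 := by
      funext u
      rw [Finset.sum_ite_eq, if_pos (Finset.mem_powerset.2 splitCell_subset), List.map_cons,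
        splitWeight]
    rw [h]
    refine Finset.measurable_sum _ fun G hG => Measurable.ite ?_ (measurable_const.mul (ih' G))
      measurable_const
    have hset : {u | splitCell (c u) F y = G} =
        ⋂ z ∈ F, {u | (z ∈ c u ↔ y ∈ c u) ↔ z ∈ G} := by
      ext u
      simp only [Set.mem_ofPred_eq, Set.mem_iInter, Finset.ext_iff, mem_splitCell]
      constructor
      · intro h z hz
        rw [← h z]
        tauto
      · intro h z
        constructor
        · rintro ⟨hz, h'⟩
          exact (h z hz).1 h'
        · intro hz
          have hzF := Finset.mem_powerset.1 hG hz
          exact ⟨hzF, (h z hzF).2 hz⟩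
    rw [hset]
    refine Finset.measurableSet_biInter _ fun z _ => ?_
    exact ((hc z).iff (hc y)).iff (MeasurableSet.const _)

end SplitWeight

/-! ### Averaging over the fibres -/

section FiberWeight

variable {X Y : Type*} [TopologicalSpace X] [TopologicalSpace Y]

/-! ### Sequences of functions separating the points of all fibres -/

theorem ContinuousMap.exists_injOn_of_finite [CompactSpace Y] [T2Space Y] {s : Set Y}
    (hs : s.Finite) : ∃ e : C(Y, ℝ), Set.InjOn e s := by
  have := hs.to_subtype
  obtain ⟨e, he⟩ := ContinuousMap.exists_restrict_eq hs.isClosed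
    (⟨fun y : s => ((Finite.equivFin s y : ℕ) : ℝ), continuous_of_discreteTopology⟩ : C(s, ℝ))
  refine ⟨e, fun y hy y' hy' h => ?_⟩
  have h1 := DFunLike.congr_fun he ⟨y, hy⟩
  have h2 := DFunLike.congr_fun he ⟨y', hy'⟩
  simp only [ContinuousMap.restrict_apply, ContinuousMap.coe_mk] at h1 h2
  rw [h1, h2, Nat.cast_inj, Fin.val_inj, EmbeddingLike.apply_eq_iff_eq, Subtype.mk.injEq] at h
  exact h

/-- Let `e` be injective on the fibre of `x`. A nearby fibre has, for each `y` over `x`, a point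
whose `e`-value is close to `e y`; these values are distinct, and a fibre of the same cardinality
has no further points. -/
theorem IsOpenMap.exists_injOn_nearby_fibers [CompactSpace Y] [T2Space Y] {p : Y → X}
    (ho : IsOpenMap p) (hfin : ∀ x, (p ⁻¹' {x}).Finite) (x : X) :
    ∃ e : C(Y, ℝ), ∀ᶠ z in 𝓝 x, (p ⁻¹' {z}).ncard = (p ⁻¹' {x}).ncard →
      Set.InjOn e (p ⁻¹' {z}) := by
  obtain ⟨e, he⟩ := ContinuousMap.exists_injOn_of_finite (hfin x)
  obtain ⟨U, hU, hd⟩ := ((hfin x).image e).t2_separation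
  refine ⟨e, ?_⟩
  filter_upwards [ho.eventually_forall_fiber (hfin x) (V := fun y => e ⁻¹' U (e y))
    fun y _ => ((hU _).2.preimage e.continuous).mem_nhds (hU _).1] with z hz hcard
  choose! s hs hps using hz
  have hval : ∀ y ∈ p ⁻¹' {x}, ∀ y' ∈ p ⁻¹' {x}, e (s y) = e (s y') → y = y' := by
    intro y hy y' hy' h
    refine he hy hy' ?_
    by_contra hne
    refine Set.disjoint_left.1 (hd ⟨y, hy, rfl⟩ ⟨y', hy', rfl⟩ hne) (hs y hy) ?_
    rw [h]
    exact hs y' hy'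
  have hinj : Set.InjOn s (p ⁻¹' {x}) := fun y hy y' hy' h => hval y hy y' hy' (by rw [h])
  have hsub : s '' (p ⁻¹' {x}) ⊆ p ⁻¹' {z} := by
    rintro _ ⟨y, hy, rfl⟩
    exact hps y hy
  have heq := Set.eq_of_subset_of_ncard_le hsub (by rw [hinj.ncard_image, hcard]) (hfin _)
  rw [← heq]
  rintro _ ⟨y, hy, rfl⟩ _ ⟨y', hy', rfl⟩ h
  rw [hval y hy y' hy' h]

/-- By second countability, countably many of the local functions suffice on each set of points with
a given number of pre-images, and there are countably many such sets. -/
theorem IsOpenMap.exists_seq_separating_fibers [SecondCountableTopology X] [CompactSpace Y]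
    [T2Space Y] {p : Y → X} (ho : IsOpenMap p) (hfin : ∀ x, (p ⁻¹' {x}).Finite) :
    ∃ e : ℕ → C(Y, ℝ), ∀ y y', p y = p y' → y ≠ y' → ∃ i, e i y ≠ e i y' := by
  choose e he using ho.exists_injOn_nearby_fibers hfin
  have hcov : ∀ j : ℕ, ∃ t ⊆ {x | (p ⁻¹' {x}).ncard = j}, t.Countable ∧
      {x | (p ⁻¹' {x}).ncard = j} ⊆ ⋃ x ∈ t, {z | (p ⁻¹' {z}).ncard = (p ⁻¹' {x}).ncard →
        Set.InjOn (e x) (p ⁻¹' {z})} := fun j =>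
    TopologicalSpace.countable_cover_nhdsWithin fun x _ => mem_nhdsWithin_of_mem_nhds (he x)
  choose t hts htc htcov using hcov
  -- The function `0` only ensures that the set is nonempty, hence the range of a sequence.
  have hcount : (insert 0 (⋃ j, e '' t j)).Countable :=
    (Set.countable_iUnion fun j => (htc j).image e).insert 0
  obtain ⟨g, hg⟩ := hcount.exists_eq_range (Set.insert_nonempty _ _)
  refine ⟨g, fun y y' hyy' hne => ?_⟩
  obtain ⟨x, hx, hz⟩ := Set.mem_iUnion₂.1 (htcov _ (show p y ∈ {x | _ = _} from rfl))
  have hmem : e x ∈ Set.range g :=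
    hg ▸ Set.mem_insert_of_mem _ (Set.mem_iUnion.2 ⟨_, x, hx, rfl⟩)
  obtain ⟨i, hi⟩ := hmem
  refine ⟨i, fun h => hne ?_⟩
  rw [hi] at h
  exact hz (hts _ hx).symm rfl hyy'.symm h

/-- The functions are `e i - q` with `q` rational: if `e i y < e i y'`, a rational between `e i y +
u` and `e i y' + u` gives a threshold that separates the two points. Thus separation holds for every
shift `u`, while the boundary of each set moves with `u`. -/
theorem IsOpenMap.exists_seq_thresholds [SecondCountableTopology X] [CompactSpace Y]
    [T2Space Y] {p : Y → X} (ho : IsOpenMap p) (hfin : ∀ x, (p ⁻¹' {x}).Finite) :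
    ∃ a : ℕ → C(Y, ℝ), ∀ y y', p y = p y' → y ≠ y' → ∀ u : ℝ,
      ∃ j, ¬ (0 < a j y + u ↔ 0 < a j y' + u) := by
  obtain ⟨e, he⟩ := ho.exists_seq_separating_fibers hfin
  obtain ⟨g, hg⟩ := exists_surjective_nat (ℕ × ℚ)
  let a : ℕ → C(Y, ℝ) := fun j => e (g j).1 - ContinuousMap.const Y ((g j).2 : ℝ)
  have key : ∀ y y' i, e i y < e i y' → ∀ u : ℝ, ∃ j, ¬ (0 < a j y + u ↔ 0 < a j y' + u) := by
    intro y y' i h u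
    obtain ⟨q, hq, hq'⟩ := exists_rat_btwn (add_lt_add_left h u)
    obtain ⟨j, hj⟩ := hg (i, q)
    refine ⟨j, fun hiff => ?_⟩
    simp only [a, hj, ContinuousMap.sub_apply, ContinuousMap.const_apply] at hiff
    have := hiff.2 (by linarith)
    linarith
  refine ⟨a, fun y y' hyy' hne u => ?_⟩
  obtain ⟨i, hi⟩ := he y y' hyy' hne
  rcases lt_or_gt_of_ne hi with h | h
  · exact key y y' i h u
  · obtain ⟨j, hj⟩ := key y' y i h u
    exact ⟨j, fun h => hj h.symm⟩

/-- The first `n` threshold sets `{y | 0 < a j y + u}`. -/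
def thresholdList (a : ℕ → C(Y, ℝ)) (u : ℝ) (n : ℕ) : List (Set Y) :=
  (List.range n).map fun j => {y | 0 < a j y + u}

/-- The weight of `y` in the finite set `F` after splitting by all threshold sets. -/
noncomputable def thresholdWeight (a : ℕ → C(Y, ℝ)) (F : Finset Y) (u : ℝ) (y : Y) : ℝ :=
  limUnder atTop fun n => splitWeight (thresholdList a u n) F y

/-- The threshold weight of `y` in `F`, averaged over all thresholds in `[0, 1]`. -/
noncomputable def meanWeight (a : ℕ → C(Y, ℝ)) (F : Finset Y) (y : Y) : ℝ :=
  ∫ u in Set.Icc (0 : ℝ) 1, thresholdWeight a F u y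

theorem mem_thresholdList {a : ℕ → C(Y, ℝ)} {u : ℝ} {n : ℕ} {c : Set Y} :
    c ∈ thresholdList a u n ↔ ∃ j < n, {y | 0 < a j y + u} = c := by
  simp [thresholdList]

theorem thresholdList_add (a : ℕ → C(Y, ℝ)) (u : ℝ) (n m : ℕ) :
    ∃ L, thresholdList a u (n + m) = thresholdList a u n ++ L := by
  rw [thresholdList, List.range_add, List.map_append]
  exact ⟨_, rfl⟩

/-! ### Threshold weights, their means, and continuity of the averages -/

variable {a : ℕ → C(Y, ℝ)} {F : Finset Y}

theorem exists_thresholdList_separates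
    (ha : ∀ y ∈ F, ∀ y' ∈ F, y ≠ y' → ∀ u : ℝ, ∃ j, ¬ (0 < a j y + u ↔ 0 < a j y' + u)) (u : ℝ) :
    ∃ n, ∀ y ∈ F, ∀ y' ∈ F, (∀ c ∈ thresholdList a u n, (y ∈ c ↔ y' ∈ c)) → y = y' := by
  have h : ∀ y y', ∃ j, y ∈ F → y' ∈ F → y ≠ y' → ¬ (0 < a j y + u ↔ 0 < a j y' + u) := by
    intro y y'
    by_cases h : y ∈ F ∧ y' ∈ F ∧ y ≠ y'
    · obtain ⟨j, hj⟩ := ha y h.1 y' h.2.1 h.2.2 u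
      exact ⟨j, fun _ _ _ => hj⟩
    · exact ⟨0, fun h1 h2 h3 => (h ⟨h1, h2, h3⟩).elim⟩
  choose j hj using h
  refine ⟨(F.sup fun y => F.sup fun y' => j y y') + 1, fun y hy y' hy' hc => ?_⟩
  by_contra hne
  refine hj y y' hy hy' hne (hc {z | 0 < a (j y y') z + u} (mem_thresholdList.2 ⟨_, ?_, rfl⟩))
  have h1 : j y y' ≤ F.sup fun y' => j y y' := Finset.le_sup (f := fun y' => j y y') hy'
  have h2 : (F.sup fun y' => j y y') ≤ F.sup fun y => F.sup fun y' => j y y' :=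
    Finset.le_sup (f := fun y => F.sup fun y' => j y y') hy
  omega

theorem thresholdWeight_eq {u : ℝ} {n : ℕ}
    (hn : ∀ y ∈ F, ∀ y' ∈ F, (∀ c ∈ thresholdList a u n, (y ∈ c ↔ y' ∈ c)) → y = y')
    {y : Y} (hy : y ∈ F) (m : ℕ) :
    splitWeight (thresholdList a u (n + m)) F y = thresholdWeight a F u y := by
  have h : ∀ m, splitWeight (thresholdList a u (n + m)) F y =
      splitWeight (thresholdList a u n) F y := by
    intro m
    obtain ⟨L, hL⟩ := thresholdList_add a u n m
    rw [hL, splitWeight_append_of_separates _ _ hn hy]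
  rw [h, thresholdWeight]
  symm
  refine Tendsto.limUnder_eq (tendsto_atTop_of_eventually_const (i₀ := n) fun i hi => ?_)
  obtain ⟨m, rfl⟩ := Nat.exists_eq_add_of_le hi
  exact h m

theorem tendsto_thresholdWeight
    (ha : ∀ y ∈ F, ∀ y' ∈ F, y ≠ y' → ∀ u : ℝ, ∃ j, ¬ (0 < a j y + u ↔ 0 < a j y' + u)) (u : ℝ)
    {y : Y} (hy : y ∈ F) :
    Tendsto (fun n => splitWeight (thresholdList a u n) F y) atTop
      (𝓝 (thresholdWeight a F u y)) := by
  obtain ⟨n, hn⟩ := exists_thresholdList_separates ha u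
  refine tendsto_atTop_of_eventually_const (i₀ := n) fun i hi => ?_
  obtain ⟨m, rfl⟩ := Nat.exists_eq_add_of_le hi
  exact thresholdWeight_eq hn hy m

theorem measurable_thresholdWeight
    (ha : ∀ y ∈ F, ∀ y' ∈ F, y ≠ y' → ∀ u : ℝ, ∃ j, ¬ (0 < a j y + u ↔ 0 < a j y' + u))
    {y : Y} (hy : y ∈ F) : Measurable fun u => thresholdWeight a F u y := by
  refine measurable_of_tendsto_metrizable
    (f := fun n u => splitWeight (thresholdList a u n) F y) (fun n => ?_)
    (tendsto_pi_nhds.2 fun u => tendsto_thresholdWeight ha u hy)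
  have h : (fun u => splitWeight (thresholdList a u n) F y) = fun u =>
      splitWeight (((List.range n).map fun j u => {y | 0 < a j y + u}).map fun c => c u) F y := by
    funext u
    rw [List.map_map]
    rfl
  rw [h]
  refine measurable_splitWeight _ (fun c hc z => ?_) F y
  obtain ⟨j, -, rfl⟩ := List.mem_map.1 hc
  exact measurableSet_lt measurable_const (measurable_const.add measurable_id)

theorem sum_thresholdWeight
    (ha : ∀ y ∈ F, ∀ y' ∈ F, y ≠ y' → ∀ u : ℝ, ∃ j, ¬ (0 < a j y + u ↔ 0 < a j y' + u)) (u : ℝ)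
    (hF : F.Nonempty) : ∑ y ∈ F, thresholdWeight a F u y = 1 := by
  obtain ⟨n, hn⟩ := exists_thresholdList_separates ha u
  rw [← sum_splitWeight (thresholdList a u n) hF]
  exact Finset.sum_congr rfl fun y hy => (thresholdWeight_eq hn hy 0).symm

theorem le_thresholdWeight
    (ha : ∀ y ∈ F, ∀ y' ∈ F, y ≠ y' → ∀ u : ℝ, ∃ j, ¬ (0 < a j y + u ↔ 0 < a j y' + u)) (u : ℝ)
    {y : Y} (hy : y ∈ F) : (1 / 2 : ℝ) ^ F.card ≤ thresholdWeight a F u y := by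
  obtain ⟨n, hn⟩ := exists_thresholdList_separates ha u
  rw [← thresholdWeight_eq hn hy 0]
  exact le_splitWeight _ hy

theorem thresholdWeight_nonneg
    (ha : ∀ y ∈ F, ∀ y' ∈ F, y ≠ y' → ∀ u : ℝ, ∃ j, ¬ (0 < a j y + u ↔ 0 < a j y' + u)) (u : ℝ)
    {y : Y} (hy : y ∈ F) : 0 ≤ thresholdWeight a F u y :=
  (by positivity : (0 : ℝ) ≤ (1 / 2) ^ F.card).trans (le_thresholdWeight ha u hy)

theorem thresholdWeight_le_one
    (ha : ∀ y ∈ F, ∀ y' ∈ F, y ≠ y' → ∀ u : ℝ, ∃ j, ¬ (0 < a j y + u ↔ 0 < a j y' + u)) (u : ℝ)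
    {y : Y} (hy : y ∈ F) : thresholdWeight a F u y ≤ 1 := by
  rw [← sum_thresholdWeight ha u ⟨y, hy⟩]
  exact Finset.single_le_sum (f := fun y => thresholdWeight a F u y)
    (fun z hz => thresholdWeight_nonneg ha u hz) hy

theorem integrable_thresholdWeight
    (ha : ∀ y ∈ F, ∀ y' ∈ F, y ≠ y' → ∀ u : ℝ, ∃ j, ¬ (0 < a j y + u ↔ 0 < a j y' + u))
    {y : Y} (hy : y ∈ F) :
    IntegrableOn (fun u => thresholdWeight a F u y) (Set.Icc 0 1) := by
  refine Integrable.of_bound (measurable_thresholdWeight ha hy).aestronglyMeasurable 1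
    (Eventually.of_forall fun u => ?_)
  rw [Real.norm_of_nonneg (thresholdWeight_nonneg ha u hy)]
  exact thresholdWeight_le_one ha u hy

theorem le_meanWeight
    (ha : ∀ y ∈ F, ∀ y' ∈ F, y ≠ y' → ∀ u : ℝ, ∃ j, ¬ (0 < a j y + u ↔ 0 < a j y' + u))
    {y : Y} (hy : y ∈ F) : (1 / 2 : ℝ) ^ F.card ≤ meanWeight a F y := by
  have h : ∫ _ in Set.Icc (0 : ℝ) 1, (1 / 2 : ℝ) ^ F.card = (1 / 2 : ℝ) ^ F.card := by
    simp
  rw [← h, meanWeight]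
  exact integral_mono (integrable_const _) (integrable_thresholdWeight ha hy)
    fun u => le_thresholdWeight ha u hy

theorem sum_meanWeight
    (ha : ∀ y ∈ F, ∀ y' ∈ F, y ≠ y' → ∀ u : ℝ, ∃ j, ¬ (0 < a j y + u ↔ 0 < a j y' + u))
    (hF : F.Nonempty) : ∑ y ∈ F, meanWeight a F y = 1 := by
  simp only [meanWeight]
  rw [← integral_finsetSum _ fun y hy => integrable_thresholdWeight ha hy]
  simp [sum_thresholdWeight ha _ hF]

theorem sum_meanWeight_mul
    (ha : ∀ y ∈ F, ∀ y' ∈ F, y ≠ y' → ∀ u : ℝ, ∃ j, ¬ (0 < a j y + u ↔ 0 < a j y' + u))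
    (f : Y → ℂ) : ∑ y ∈ F, (meanWeight a F y : ℂ) * f y =
      ∫ u in Set.Icc (0 : ℝ) 1, ∑ y ∈ F, (thresholdWeight a F u y : ℂ) * f y := by
  rw [integral_finsetSum _ fun y hy => (integrable_thresholdWeight ha hy).ofReal.mul_const _]
  refine Finset.sum_congr rfl fun y hy => ?_
  rw [integral_mul_const, meanWeight, integral_complex_ofReal]

/-- The averages over the fibres with the threshold weights are continuous at every point
whose fibre avoids the boundaries of the threshold sets. -/
theorem tendsto_sum_thresholdWeight [CompactSpace Y] [T2Space Y] [T2Space X] {p : C(Y, X)}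
    (ho : IsOpenMap p) {F : X → Finset Y} (hF : ∀ x y, y ∈ F x ↔ p y = x)
    (ha : ∀ y y', p y = p y' → y ≠ y' → ∀ u : ℝ, ∃ j, ¬ (0 < a j y + u ↔ 0 < a j y' + u))
    {x : X} (hne : (F x).Nonempty) {u : ℝ} (hu : ∀ y ∈ F x, ∀ j, a j y + u ≠ 0) (f : C(Y, ℂ)) :
    Tendsto (fun z => ∑ y ∈ F z, (thresholdWeight a (F z) u y : ℂ) * f y) (𝓝 x)
      (𝓝 (∑ y ∈ F x, (thresholdWeight a (F x) u y : ℂ) * f y)) := by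
  have ha' : ∀ x, ∀ y ∈ F x, ∀ y' ∈ F x, y ≠ y' → ∀ u : ℝ,
      ∃ j, ¬ (0 < a j y + u ↔ 0 < a j y' + u) := fun x y hy y' hy' =>
    ha y y' (((hF x y).1 hy).trans ((hF x y').1 hy').symm)
  have hfib : ∀ x, p ⁻¹' {x} = F x := fun x => by ext y; simp [hF]
  have hfin : (p ⁻¹' {x}).Finite := by rw [hfib]; exact (F x).finite_toSet
  obtain ⟨n, hn⟩ := exists_thresholdList_separates (ha' x) u
  rw [Metric.tendsto_nhds]
  intro ε hε
  obtain ⟨S, hS, hd⟩ := hfin.t2_separation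
  -- Near `y`, the first `n` thresholds do not distinguish `w` from `y`, because `a j y + u` is
  -- nonzero. These `n` thresholds already separate the fibre of `x`.
  let V : Y → Set Y := fun y =>
    {w | w ∈ S y ∧ (∀ j < n, (0 < a j w + u ↔ 0 < a j y + u)) ∧ ‖f w - f y‖ ≤ ε / 2}
  have hV : ∀ y ∈ p ⁻¹' {x}, V y ∈ 𝓝 y := by
    intro y hy
    refine inter_mem ((hS y).2.mem_nhds (hS y).1) (inter_mem ?_ ?_)
    · have : ∀ j ∈ Set.Iio n, ∀ᶠ w in 𝓝 y, (0 < a j w + u ↔ 0 < a j y + u) := by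
        intro j _
        have hc : ContinuousAt (fun w => a j w + u) y := by fun_prop
        rcases lt_or_gt_of_ne (hu y ((hF x y).2 hy) j) with h | h
        · filter_upwards [hc.eventually (gt_mem_nhds h)] with w hw
          exact ⟨fun h' => (lt_asymm h' hw).elim, fun h' => (lt_asymm h' h).elim⟩
        · filter_upwards [hc.eventually (lt_mem_nhds h)] with w hw
          exact ⟨fun _ => h, fun _ => hw⟩
      exact (eventually_all_finite (Set.finite_Iio n)).2 this
    · have hc : ContinuousAt (fun w => ‖f w - f y‖) y := by fun_prop
      have h0 : ‖f y - f y‖ < ε / 2 := by simpa using hε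
      exact (hc.eventually (gt_mem_nhds h0)).mono fun w hw => le_of_lt hw
  -- Since `p` is closed, nearby fibres lie entirely in the union of the sets `V y`; this yields the
  -- map `π` to the fibre of `x`. Openness provides its surjectivity.
  have hcover : ∀ᶠ z in 𝓝 x, ∀ w, p w = z → ∃ y ∈ p ⁻¹' {x}, w ∈ V y := by
    have := p.continuous.isClosedMap.eventually_nhds_fiber
      (p := fun w => ∃ y ∈ p ⁻¹' {x}, w ∈ V y) x fun y hy => by
        filter_upwards [hV y hy] with w hw using ⟨y, hy, hw⟩
    filter_upwards [this] with z hz w hw using hz w hw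
  filter_upwards [hcover, ho.eventually_forall_fiber hfin hV] with z hz hz'
  choose! π hπ hπV using hz
  -- The fibre of `z` may need more than `n` thresholds; the additional ones form `L` and only
  -- redistribute mass within the clusters.
  obtain ⟨m, hm⟩ := exists_thresholdList_separates (ha' z) u
  obtain ⟨L, hL⟩ := thresholdList_add a u n m
  obtain ⟨y₀, hy₀⟩ := hne
  obtain ⟨w₀, -, hw₀⟩ := hz' y₀ ((hF x y₀).1 hy₀)
  have h1 : ∑ y ∈ F z, (thresholdWeight a (F z) u y : ℂ) * f y =
      ∑ y ∈ F z, (splitWeight (thresholdList a u n ++ L) (F z) y : ℂ) * f y := by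
    refine Finset.sum_congr rfl fun y hy => ?_
    rw [← thresholdWeight_eq hm hy n, add_comm m n, hL]
  have h2 : ∑ y ∈ F x, (thresholdWeight a (F x) u y : ℂ) * f y =
      ∑ y ∈ F x, (splitWeight (thresholdList a u n) (F x) y : ℂ) * f y := by
    refine Finset.sum_congr rfl fun y hy => ?_
    rw [← thresholdWeight_eq hn hy 0, add_zero]
  rw [h1, h2, dist_eq_norm]
  refine (norm_sum_splitWeight_sub_le (thresholdList a u n) L (π := π) (ε := ε / 2)
    ⟨w₀, (hF z w₀).2 hw₀⟩ (fun w hw => (hF x _).2 (hπ w ((hF z w).1 hw))) ?_ ?_ hn ?_).trans_lt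
    (half_lt_self hε)
  · intro y hy
    have hy' : y ∈ p ⁻¹' {x} := (hF x y).1 hy
    obtain ⟨w, hwV, hw⟩ := hz' y hy'
    refine ⟨w, (hF z w).2 hw, ?_⟩
    by_contra hne
    exact Set.disjoint_left.1 (hd (hπ w hw) hy' hne) (hπV w hw).1 hwV.1
  · intro c hc w hw
    obtain ⟨j, hj, rfl⟩ := mem_thresholdList.1 hc
    exact (hπV w ((hF z w).1 hw)).2.1 j hj
  · exact fun w hw => (hπV w ((hF z w).1 hw)).2.2

theorem continuous_sum_meanWeight [CompactSpace Y] [T2Space Y] [T2Space X]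
    [FirstCountableTopology X] {p : C(Y, X)}
    (ho : IsOpenMap p) {F : X → Finset Y} (hF : ∀ x y, y ∈ F x ↔ p y = x)
    (ha : ∀ y y', p y = p y' → y ≠ y' → ∀ u : ℝ, ∃ j, ¬ (0 < a j y + u ↔ 0 < a j y' + u))
    (hne : ∀ x, (F x).Nonempty) (f : C(Y, ℂ)) :
    Continuous fun x => ∑ y ∈ F x, (meanWeight a (F x) y : ℂ) * f y := by
  have ha' : ∀ x, ∀ y ∈ F x, ∀ y' ∈ F x, y ≠ y' → ∀ u : ℝ,
      ∃ j, ¬ (0 < a j y + u ↔ 0 < a j y' + u) := fun x y hy y' hy' =>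
    ha y y' (((hF x y).1 hy).trans ((hF x y').1 hy').symm)
  simp_rw [fun x => sum_meanWeight_mul (ha' x) f]
  rw [continuous_iff_continuousAt]
  intro x
  refine tendsto_integral_filter_of_dominated_convergence (fun _ => ‖f‖)
    (Eventually.of_forall fun z => ?_) (Eventually.of_forall fun z =>
      Eventually.of_forall fun u => ?_) (integrable_const _) ?_
  · refine Measurable.aestronglyMeasurable (Finset.measurable_sum _ fun y hy => ?_)
    exact (Complex.measurable_ofReal.comp (measurable_thresholdWeight (ha' z) hy)).mul_const _
  · calc _ ≤ ∑ y ∈ F z, ‖(thresholdWeight a (F z) u y : ℂ) * f y‖ := norm_sum_le _ _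
      _ ≤ ∑ y ∈ F z, thresholdWeight a (F z) u y * ‖f‖ := by
        refine Finset.sum_le_sum fun y hy => ?_
        rw [norm_mul, Complex.norm_real, Real.norm_of_nonneg (thresholdWeight_nonneg (ha' z) u hy)]
        exact mul_le_mul_of_nonneg_left (f.norm_coe_le_norm y)
          (thresholdWeight_nonneg (ha' z) u hy)
      _ = ‖f‖ := by rw [← Finset.sum_mul, sum_thresholdWeight (ha' z) u (hne z), one_mul]
  -- The exceptional `u` are the numbers `-(a j y)`, with `j` natural and `y` in the finite fibre of
  -- `x`: a countable set.
  · have hae : ∀ᵐ u : ℝ ∂volume.restrict (Set.Icc (0 : ℝ) 1), ∀ y ∈ F x, ∀ j, a j y + u ≠ 0 := by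
      refine ae_restrict_of_ae ((eventually_all_finset (F x)).2 fun y _ => ae_all_iff.2 fun j => ?_)
      filter_upwards [compl_mem_ae_iff.2 (measure_singleton (-(a j y)))] with u hu h
      exact hu (by rw [Set.mem_singleton_iff]; linarith)
    filter_upwards [hae] with u hu
    exact tendsto_sum_thresholdWeight ho hF ha (hne x) hu f

end FiberWeight

/-! ### The Hilbert module of a fibrewise average -/

section FiberAverage

theorem IsOpenMap.exists_fiber_weight {X Y : Type*} [TopologicalSpace X] [T2Space X]
    [SecondCountableTopology X] [TopologicalSpace Y] [CompactSpace Y] [T2Space Y] {p : C(Y, X)}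
    (ho : IsOpenMap p) (hs : Function.Surjective p) {F : X → Finset Y}
    (hF : ∀ x y, y ∈ F x ↔ p y = x) {N : ℕ} (hN : ∀ x, (F x).card ≤ N) :
    ∃ (μ : Y → ℝ) (c : ℝ), 0 < c ∧ (∀ y, c ≤ μ y) ∧ (∀ x, ∑ y ∈ F x, μ y = 1) ∧
      ∀ f : C(Y, ℂ), Continuous fun x => ∑ y ∈ F x, (μ y : ℂ) * f y := by
  have hfin : ∀ x, (p ⁻¹' {x}).Finite := fun x => by
    have : p ⁻¹' {x} = F x := by ext y; simp [hF]
    rw [this]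
    exact (F x).finite_toSet
  obtain ⟨a, ha⟩ := ho.exists_seq_thresholds hfin
  have ha' : ∀ x, ∀ y ∈ F x, ∀ y' ∈ F x, y ≠ y' → ∀ u : ℝ,
      ∃ j, ¬ (0 < a j y + u ↔ 0 < a j y' + u) := fun x y hy y' hy' =>
    ha y y' (((hF x y).1 hy).trans ((hF x y').1 hy').symm)
  have hne : ∀ x, (F x).Nonempty := fun x => by
    obtain ⟨y, hy⟩ := hs x
    exact ⟨y, (hF x y).2 hy⟩
  have hμ : ∀ x, ∀ y ∈ F x, meanWeight a (F (p y)) y = meanWeight a (F x) y := fun x y hy => by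
    rw [(hF x y).1 hy]
  -- Each point is weighted within its own fibre, which has at most `N` points; hence the uniform
  -- lower bound.
  refine ⟨fun y => meanWeight a (F (p y)) y, (1 / 2) ^ N, by positivity, fun y => ?_, fun x => ?_,
    fun f => ?_⟩
  · exact (pow_le_pow_of_le_one (by norm_num) (by norm_num) (hN _)).trans
      (le_meanWeight (ha' _) ((hF _ y).2 rfl))
  · rw [Finset.sum_congr rfl (hμ x), sum_meanWeight (ha' x) (hne x)]
  · convert continuous_sum_meanWeight ho hF ha hne f using 2 with x
    exact Finset.sum_congr rfl fun y hy => congrArg (fun r : ℝ => (r : ℂ) * f y) (hμ x y hy)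

theorem completeSpace_of_norm_equivalence {E E' : Type*} [NormedAddCommGroup E]
    [NormedAddCommGroup E'] [CompleteSpace E] (φ : E →+ E') (hφ : Function.Surjective φ)
    {c C : ℝ} (hc : 0 < c) (h : ∀ x, c * ‖x‖ ≤ ‖φ x‖ ∧ ‖φ x‖ ≤ C * ‖x‖) : CompleteSpace E' := by
  have h1 : AntilipschitzWith (Real.toNNReal c⁻¹) φ :=
    AddMonoidHomClass.antilipschitz_of_bound φ fun x => by
      rw [Real.coe_toNNReal _ (by positivity), inv_mul_eq_div, le_div_iff₀ hc, mul_comm]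
      exact (h x).1
  have h2 := AddMonoidHomClass.lipschitz_of_bound φ C fun x => (h x).2
  exact ((h1.isUniformInducing h2.uniformContinuous).completeSpace_congr hφ).1 inferInstance

variable {X Y : Type*} [TopologicalSpace X] [CompactSpace X]
  [TopologicalSpace Y] [CompactSpace Y] (p : C(Y, X)) (F : X → Finset Y) (μ : Y → ℝ)
  (hE : ∀ f : C(Y, ℂ), Continuous fun x => ∑ y ∈ F x, (μ y : ℂ) * f y)

/-- The weighted average `⟨f, g⟩ (x) = ∑ μ(y) conj (f y) g(y)` over the fibres. -/
noncomputable def fiberInner (f g : C(Y, ℂ)) : C(X, ℂ) :=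
  ⟨fun x => ∑ y ∈ F x, (μ y : ℂ) * (star f * g) y, hE (star f * g)⟩

omit [CompactSpace X] [CompactSpace Y] in
theorem fiberInner_apply (f g : C(Y, ℂ)) (x : X) :
    fiberInner F μ hE f g x = ∑ y ∈ F x, (μ y : ℂ) * (starRingEnd ℂ (f y) * g y) := rfl

omit [CompactSpace X] [CompactSpace Y] in
theorem fiberInner_self_apply (f : C(Y, ℂ)) (x : X) :
    fiberInner F μ hE f f x = ((∑ y ∈ F x, μ y * ‖f y‖ ^ 2 : ℝ) : ℂ) := by
  rw [fiberInner_apply, Complex.ofReal_sum]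
  refine Finset.sum_congr rfl fun y _ => ?_
  rw [RCLike.conj_mul]
  push_cast
  rfl

variable {p F μ} (hF : ∀ x y, y ∈ F x ↔ p y = x) {c : ℝ} (hc : 0 < c) (hμ : ∀ y, c ≤ μ y)
  (hμ1 : ∀ x, ∑ y ∈ F x, μ y = 1)

omit [CompactSpace Y] in
include hF hc hμ in
theorem le_norm_fiberInner_self (f : C(Y, ℂ)) (y : Y) :
    c * ‖f y‖ ^ 2 ≤ ‖fiberInner F μ hE f f‖ := by
  have hpos : ∀ z, 0 ≤ μ z * ‖f z‖ ^ 2 := fun z =>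
    mul_nonneg (hc.le.trans (hμ z)) (sq_nonneg _)
  calc c * ‖f y‖ ^ 2 ≤ μ y * ‖f y‖ ^ 2 := mul_le_mul_of_nonneg_right (hμ y) (sq_nonneg _)
    _ ≤ ∑ z ∈ F (p y), μ z * ‖f z‖ ^ 2 :=
        Finset.single_le_sum (f := fun z => μ z * ‖f z‖ ^ 2) (fun z _ => hpos z)
          ((hF _ y).2 rfl)
    _ = ‖fiberInner F μ hE f f (p y)‖ := by
        rw [fiberInner_self_apply, Complex.norm_real,
          Real.norm_of_nonneg (Finset.sum_nonneg fun z _ => hpos z)]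
    _ ≤ _ := ContinuousMap.norm_coe_le_norm _ _

include hF hc hμ in
theorem sqrt_mul_norm_le_fiberInner (f : C(Y, ℂ)) :
    √c * ‖f‖ ≤ √‖fiberInner F μ hE f f‖ := by
  rw [mul_comm, ← le_div_iff₀ (Real.sqrt_pos.2 hc), ContinuousMap.norm_le _ (by positivity)]
  intro y
  rw [le_div_iff₀ (Real.sqrt_pos.2 hc)]
  refine Real.le_sqrt_of_sq_le ?_
  rw [mul_pow, Real.sq_sqrt hc.le, mul_comm]
  exact le_norm_fiberInner_self hE hF hc hμ f y

include hc hμ hμ1 in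
theorem fiberInner_le_norm (f : C(Y, ℂ)) : √‖fiberInner F μ hE f f‖ ≤ 1 * ‖f‖ := by
  rw [one_mul]
  refine Real.sqrt_le_iff.2 ⟨norm_nonneg _, (ContinuousMap.norm_le _ (sq_nonneg _)).2 fun x => ?_⟩
  have hpos : ∀ z, 0 ≤ μ z := fun z => hc.le.trans (hμ z)
  rw [fiberInner_self_apply, Complex.norm_real,
    Real.norm_of_nonneg (Finset.sum_nonneg fun z _ => mul_nonneg (hpos z) (sq_nonneg _))]
  calc _ ≤ ∑ y ∈ F x, μ y * ‖f‖ ^ 2 := by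
        refine Finset.sum_le_sum fun y _ => mul_le_mul_of_nonneg_left ?_ (hpos y)
        exact pow_le_pow_left₀ (norm_nonneg _) (f.norm_coe_le_norm y) 2
    _ = _ := by rw [← Finset.sum_mul, hμ1, one_mul]

/-- The Hilbert norm of a fibrewise average. -/
noncomputable abbrev fiberNorm (p : C(Y, X)) : Norm (PullbackModule p) :=
  ⟨fun f => √‖fiberInner F μ hE ((PullbackModule.of p).symm f) ((PullbackModule.of p).symm f)‖⟩

/-- The inner product of a fibrewise average. -/
noncomputable abbrev fiberCStarModule :
    @CStarModule C(X, ℂ) (PullbackModule p) _ _ _ _ _ _ _ _ (fiberNorm hE p) :=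
  letI := fiberNorm (F := F) (μ := μ) hE p
  { inner := fun f g =>
      fiberInner F μ hE ((PullbackModule.of p).symm f) ((PullbackModule.of p).symm g)
    inner_add_right := by
      intro f g h
      ext x
      simp only [map_add, ContinuousMap.add_apply, fiberInner_apply]
      rw [← Finset.sum_add_distrib]
      exact Finset.sum_congr rfl fun y _ => by ring
    inner_self_nonneg := by
      intro f
      rw [ContinuousMap.le_def]
      intro x
      rw [fiberInner_self_apply, ContinuousMap.zero_apply, Complex.zero_le_real]
      exact Finset.sum_nonneg fun y _ => mul_nonneg (hc.le.trans (hμ y)) (sq_nonneg _)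
    inner_self := by
      intro f
      constructor
      · intro h
        apply (PullbackModule.of p).symm.injective
        rw [map_zero]
        ext y
        have h1 := le_norm_fiberInner_self hE hF hc hμ ((PullbackModule.of p).symm f) y
        rw [h, norm_zero] at h1
        have h2 : ‖(PullbackModule.of p).symm f y‖ ^ 2 ≤ 0 := by
          by_contra hcon
          push Not at hcon
          exact (mul_pos hc hcon).not_ge h1
        simpa using h2.antisymm (sq_nonneg _)
      · rintro rfl
        ext x
        simp [fiberInner_apply]
    inner_op_smul_right := by
      intro a f g
      ext x
      have : (PullbackModule.of p).symm (a • g) = a.comp p * (PullbackModule.of p).symm g := rfl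
      simp only [this, ContinuousMap.mul_apply, fiberInner_apply, ContinuousMap.comp_apply]
      rw [Finset.mul_sum]
      exact Finset.sum_congr rfl fun y hy => by rw [(hF x y).1 hy]; ring
    inner_smul_right_complex := by
      intro z f g
      ext x
      simp only [map_smul, ContinuousMap.smul_apply, fiberInner_apply, smul_eq_mul]
      rw [Finset.mul_sum]
      exact Finset.sum_congr rfl fun y _ => by ring
    star_inner := by
      intro f g
      ext x
      simp only [ContinuousMap.star_apply, fiberInner_apply, Complex.star_def, map_sum, map_mul,
        Complex.conj_ofReal, Complex.conj_conj]
      exact Finset.sum_congr rfl fun y _ => by ring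
    norm_eq_sqrt_norm_inner_self := fun _ => rfl }

/-- The Hilbert product of a fibrewise average. -/
noncomputable def fiberHilbertProduct : HilbertProduct p where
  norm := fiberNorm (F := F) (μ := μ) hE p
  cstar := fiberCStarModule hE hF hc hμ
  complete := by
    let := fiberNorm (F := F) (μ := μ) hE p
    let := fiberCStarModule hE hF hc hμ
    let : NormedAddCommGroup (PullbackModule p) := CStarModule.normedAddCommGroup C(X, ℂ)
    exact completeSpace_of_norm_equivalence
      ((PullbackModule.of p : C(Y, ℂ) ≃ₗ[ℂ] PullbackModule p) : C(Y, ℂ) →+ PullbackModule p)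
      (PullbackModule.of p).surjective (Real.sqrt_pos.2 hc)
      fun f => ⟨sqrt_mul_norm_le_fiberInner hE hF hc hμ f, fiberInner_le_norm hE hc hμ hμ1 f⟩

end FiberAverage

theorem IsBranchedCovering.exists_finset_fibers {X Y : Type*} [TopologicalSpace X]
    [TopologicalSpace Y] {p : Y → X} (hp : IsBranchedCovering p) :
    ∃ (F : X → Finset Y) (N : ℕ), (∀ x y, y ∈ F x ↔ p y = x) ∧ ∀ x, (F x).card ≤ N := by
  obtain ⟨N, hN⟩ := hp.bounded_fibers
  have hfin : ∀ x, (p ⁻¹' {x}).Finite := fun x => Set.finite_of_encard_le_coe (hN x)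
  refine ⟨fun x => (hfin x).toFinset, N, fun x y => by simp, fun x => ?_⟩
  have := hN x
  rw [(hfin x).encard_eq_coe_toFinset_card] at this
  exact_mod_cast this

theorem finsum_mem_eq_sum_of_fiber {X Y M : Type*} [AddCommMonoid M] {p : Y → X}
    {F : X → Finset Y} (hF : ∀ x y, y ∈ F x ↔ p y = x) (x : X) (f : Y → M) :
    ∑ᶠ y ∈ p ⁻¹' {x}, f y = ∑ y ∈ F x, f y := by
  have : p ⁻¹' {x} = F x := by ext y; simp [hF]
  rw [this, finsum_mem_coe_finset]

/-! ### Bounded functionals on `C(Y)` -/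

section BoundedFunctional

/-- The bounded `C(X)`-linear maps `C(Y) → C(X)`, with the pointwise action of `C(X)`. -/
def boundedFunctional {X Y : Type*} [TopologicalSpace X] [CompactSpace X]
    [TopologicalSpace Y] [CompactSpace Y] (p : C(Y, X)) :
    Submodule C(X, ℂ) (PullbackModule p →ₗ[C(X, ℂ)] C(X, ℂ)) where
  carrier := {G | ∃ C : ℝ, ∀ f : C(Y, ℂ), ‖G (PullbackModule.of p f)‖ ≤ C * ‖f‖}
  add_mem' := by
    rintro G H ⟨C, hC⟩ ⟨D, hD⟩
    refine ⟨C + D, fun f => ?_⟩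
    rw [LinearMap.add_apply, add_mul]
    exact (norm_add_le _ _).trans (add_le_add (hC f) (hD f))
  zero_mem' := ⟨0, fun f => by simp⟩
  smul_mem' := by
    rintro a G ⟨C, hC⟩
    refine ⟨‖a‖ * C, fun f => ?_⟩
    rw [LinearMap.smul_apply, smul_eq_mul, mul_assoc]
    exact (norm_mul_le _ _).trans (mul_le_mul_of_nonneg_left (hC f) (norm_nonneg a))

variable {X Y : Type*} [TopologicalSpace X] [CompactSpace X]
  [TopologicalSpace Y] [CompactSpace Y] {p : C(Y, X)}

namespace boundedFunctional

/-- The value of a functional at a function on `Y`. -/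
noncomputable def eval (G : boundedFunctional p) (f : C(Y, ℂ)) : C(X, ℂ) :=
  G.1 (PullbackModule.of p f)

noncomputable instance : CoeFun (boundedFunctional p) fun _ => C(Y, ℂ) → C(X, ℂ) where
  coe := eval

@[ext] theorem ext {G H : boundedFunctional p} (h : ∀ f : C(Y, ℂ), G f = H f) : G = H :=
  Subtype.ext (LinearMap.ext fun f => h ((PullbackModule.of p).symm f))

/-- Constructor from an additive, `C(X)`-homogeneous, bounded map. -/
noncomputable def mk (G : C(Y, ℂ) → C(X, ℂ)) (hadd : ∀ f g, G (f + g) = G f + G g)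
    (hsmul : ∀ (ξ : C(X, ℂ)) f, G (ξ.comp p * f) = ξ * G f) (C : ℝ)
    (hC : ∀ f, ‖G f‖ ≤ C * ‖f‖) : boundedFunctional p :=
  ⟨{ toFun := fun f => G ((PullbackModule.of p).symm f)
     map_add' := fun _ _ => hadd _ _
     map_smul' := fun ξ _ => hsmul ξ _ }, C, hC⟩

theorem map_add (G : boundedFunctional p) (f g : C(Y, ℂ)) : G (f + g) = G f + G g :=
  _root_.map_add G.1 _ _

theorem map_sub (G : boundedFunctional p) (f g : C(Y, ℂ)) : G (f - g) = G f - G g :=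
  _root_.map_sub G.1 _ _

theorem map_sum (G : boundedFunctional p) {ι : Type*} (s : Finset ι) (f : ι → C(Y, ℂ)) :
    G (∑ i ∈ s, f i) = ∑ i ∈ s, G (f i) := by
  simp only [eval, _root_.map_sum]

theorem map_mul (G : boundedFunctional p) (ξ : C(X, ℂ)) (f : C(Y, ℂ)) :
    G (ξ.comp p * f) = ξ * G f := G.1.map_smul ξ _

theorem smul_apply (a : C(X, ℂ)) (G : boundedFunctional p) (f : C(Y, ℂ)) :
    (a • G) f = a * G f := rfl

theorem sum_apply {ι : Type*} (s : Finset ι) (G : ι → boundedFunctional p) (f : C(Y, ℂ)) :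
    (∑ i ∈ s, G i) f = ∑ i ∈ s, G i f := by
  simp only [eval, AddSubmonoidClass.coe_finsetSum, LinearMap.sum_apply]

end boundedFunctional

/-- Where `b` vanishes, the product tends to zero since `k` is bounded on `U`. This permits cutting
off local sections and indicators of sheets with arbitrary values outside `U`. -/
theorem continuous_mul_of_continuousOn {Z : Type*} [TopologicalSpace Z] {b k : Z → ℂ} {U : Set Z}
    (hb : Continuous b) (hU : IsOpen U) (hbU : ∀ z ∉ U, b z = 0) (hk : ContinuousOn k U) {C : ℝ}
    (hC : ∀ z ∈ U, ‖k z‖ ≤ C) : Continuous fun z => b z * k z := by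
  rw [continuous_iff_continuousAt]
  intro z
  by_cases hz : z ∈ U
  · exact hb.continuousAt.mul (hk.continuousAt (hU.mem_nhds hz))
  · have h0 : Tendsto (fun z => ‖b z‖ * |C|) (𝓝 z) (𝓝 0) := by
      have h1 : Tendsto (fun z => ‖b z‖ * |C|) (𝓝 z) (𝓝 (‖b z‖ * |C|)) :=
        (hb.continuousAt.norm.mul continuousAt_const)
      rwa [hbU z hz, norm_zero, zero_mul] at h1
    rw [ContinuousAt, hbU z hz, zero_mul]
    refine squeeze_zero_norm (fun w => ?_) h0
    by_cases hw : w ∈ U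
    · rw [norm_mul]
      exact mul_le_mul_of_nonneg_left ((hC w hw).trans (le_abs_self C)) (norm_nonneg _)
    · rw [hbU w hw, zero_mul, norm_zero, zero_mul]

theorem ContinuousMap.exists_bump {Z : Type*} [TopologicalSpace Z] [NormalSpace Z] [T1Space Z]
    {U : Set Z} {z : Z} (hU : U ∈ 𝓝 z) :
    ∃ b : C(Z, ℂ), b z = 1 ∧ (∀ w ∉ U, b w = 0) ∧ ∀ w, ‖b w‖ ≤ 1 := by
  obtain ⟨g, hg0, hg1, hg⟩ := exists_continuous_zero_one_of_isClosed
    (isOpen_interior (s := U)).isClosed_compl (isClosed_singleton (x := z))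
    (Set.disjoint_singleton_right.2 fun h => h (mem_interior_iff_mem_nhds.2 hU))
  refine ⟨⟨fun w => (g w : ℂ), by fun_prop⟩, ?_, fun w hw => ?_, fun w => ?_⟩
  · have : g z = 1 := hg1 rfl
    simp [this]
  · have : g w = 0 := hg0 fun h => hw (interior_subset h)
    simp [this]
  · rw [ContinuousMap.coe_mk, Complex.norm_real, Real.norm_of_nonneg (hg w).1]
    exact (hg w).2

namespace boundedFunctional

/-- The value of `G f` at `x` depends only on the restriction of `f` to the fibre of `x`. -/
theorem apply_congr [T2Space X] (G : boundedFunctional p) {x : X} {f g : C(Y, ℂ)}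
    (h : ∀ y, p y = x → f y = g y) : G f x = G g x := by
  rw [← sub_eq_zero, ← ContinuousMap.sub_apply, ← map_sub]
  obtain ⟨C, hC⟩ := G.2
  -- As `p` is closed, `f - g` is small on all fibres near `x`. Multiplication by a bump function on
  -- `X` makes it uniformly small and, by `C(X)`-linearity, leaves the value of `G` at `x`
  -- unchanged.
  have key : ∀ ε > 0, ‖G (f - g) x‖ ≤ |C| * ε := by
    intro ε hε
    have hev := p.continuous.isClosedMap.eventually_nhds_fiber
      (p := fun w => ‖(f - g) w‖ < ε) x fun y hy => by
        have hc : ContinuousAt (fun w => ‖(f - g) w‖) y := by fun_prop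
        refine hc.eventually (gt_mem_nhds ?_)
        have hy' : p y = x := hy
        simpa [h y hy'] using hε
    obtain ⟨b, hb1, hb0, hb⟩ := ContinuousMap.exists_bump hev
    have h1 : G (f - g) x = G (b.comp p * (f - g)) x := by
      rw [map_mul, ContinuousMap.mul_apply, hb1, one_mul]
    have h2 : ‖b.comp p * (f - g)‖ ≤ ε := by
      refine (ContinuousMap.norm_le _ hε.le).2 fun w => ?_
      rw [ContinuousMap.mul_apply, ContinuousMap.comp_apply, norm_mul]
      by_cases hw : ∀ w', p w' = p w → ‖(f - g) w'‖ < ε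
      · calc _ ≤ 1 * ε := mul_le_mul (hb _) (hw w rfl).le (norm_nonneg _) zero_le_one
          _ = ε := one_mul ε
      · rw [hb0 (p w) (fun hcon => hw fun w' hw' => hcon w' hw'), norm_zero, zero_mul]
        exact hε.le
    rw [h1]
    calc _ ≤ ‖G (b.comp p * (f - g))‖ := ContinuousMap.norm_coe_le_norm _ _
      _ ≤ C * ‖b.comp p * (f - g)‖ := hC _
      _ ≤ |C| * ‖b.comp p * (f - g)‖ :=
          mul_le_mul_of_nonneg_right (le_abs_self C) (norm_nonneg _)
      _ ≤ |C| * ε := mul_le_mul_of_nonneg_left h2 (abs_nonneg C)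
  rw [← norm_eq_zero]
  refine le_antisymm (le_of_forall_pos_le_add fun ε hε => ?_) (norm_nonneg _)
  calc _ ≤ |C| * (ε / (|C| + 1)) := key _ (by positivity)
    _ ≤ 0 + ε := by
      rw [zero_add, mul_div_assoc', div_le_iff₀ (by positivity)]
      nlinarith [abs_nonneg C]

/-- Evaluation along a local section `s` of `p`, cut off by the function `b`. -/
theorem exists_section_functional {U : Set X} (hU : IsOpen U) {b : C(X, ℂ)}
    (hbU : ∀ z ∉ U, b z = 0) {s : X → Y} (hs : ContinuousOn s U) (hps : ∀ z ∈ U, p (s z) = z) :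
    ∃ G : boundedFunctional p, ∀ f z, G f z = b z * f (s z) := by
  have hcont : ∀ f : C(Y, ℂ), Continuous fun z => b z * f (s z) := fun f =>
    continuous_mul_of_continuousOn b.continuous hU hbU (f.continuous.comp_continuousOn hs)
      (C := ‖f‖) fun z _ => f.norm_coe_le_norm _
  refine ⟨mk (fun f => ⟨_, hcont f⟩) (fun f g => ?_) (fun ξ f => ?_) ‖b‖ (fun f => ?_),
    fun f z => rfl⟩
  · ext z
    simp [mul_add]
  · ext z
    simp only [ContinuousMap.coe_mk, ContinuousMap.mul_apply, ContinuousMap.comp_apply]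
    by_cases hz : z ∈ U
    · rw [hps z hz]; ring
    · rw [hbU z hz]; ring
  · refine (ContinuousMap.norm_le _ (by positivity)).2 fun z => ?_
    rw [ContinuousMap.coe_mk, norm_mul]
    exact mul_le_mul (b.norm_coe_le_norm z) (f.norm_coe_le_norm _) (norm_nonneg _) (norm_nonneg _)

/-- Over a point where the number of pre-images is locally constant, every `C(X)`-linear map on
the functionals is the evaluation at an element of `C(Y)`. -/
theorem exists_eval_at [T2Space X] [T2Space Y] (ho : IsOpenMap p)
    (hfin : ∀ x, (p ⁻¹' {x}).Finite) (Θ : boundedFunctional p →ₗ[C(X, ℂ)] C(X, ℂ)) {x : X}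
    (hx : ∀ᶠ z in 𝓝 x, (p ⁻¹' {z}).ncard = (p ⁻¹' {x}).ncard) :
    ∃ m : C(Y, ℂ), ∀ G, Θ G x = G m x := by
  classical
  obtain ⟨U, V, s, hU, hxU, hd, hV, hs, hsurj⟩ := ho.exists_local_sections hfin hx
  obtain ⟨b, hb1, hb0, -⟩ := ContinuousMap.exists_bump (hU.mem_nhds hxU)
  have hev : ∀ y ∈ p ⁻¹' {x}, ∃ G : boundedFunctional p, ∀ f z, G f z = b z * f (s y z) :=
    fun y hy => exists_section_functional hU hb0 (hs y hy).1 fun z hz => ((hs y hy).2.2 z hz).1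
  choose! ev hev using hev
  have he : ∀ y ∈ p ⁻¹' {x}, ∃ e : C(Y, ℂ), ∀ w, e w = b (p w) * if w ∈ V y then 1 else 0 := by
    intro y hy
    have hcont : Continuous fun w => b (p w) * if w ∈ V y then (1 : ℂ) else 0 := by
      refine continuous_mul_of_continuousOn (U := p ⁻¹' U) (by fun_prop)
        (hU.preimage p.continuous) (fun w hw => hb0 _ hw) (fun w hw => ?_) (C := 1)
        (fun w _ => by split_ifs <;> simp)
      obtain ⟨y', hy', hw'⟩ := hsurj w hw
      have hwV : w ∈ V y' := by
        have := ((hs y' hy').2.2 (p w) hw).2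
        rwa [hw'] at this
      refine ContinuousAt.continuousWithinAt (ContinuousAt.congr
        (f := fun _ => if y' = y then (1 : ℂ) else 0) continuousAt_const ?_)
      filter_upwards [(hV y').mem_nhds hwV] with v hv
      by_cases hyy : y' = y
      · rw [if_pos hyy, if_pos (hyy ▸ hv)]
      · rw [if_neg hyy, if_neg fun hv' => Set.disjoint_left.1 (hd hy' hy hyy) hv hv']
    exact ⟨⟨_, hcont⟩, fun w => rfl⟩
  choose! e he using he
  set F := (hfin x).toFinset
  have hF : ∀ y ∈ F, y ∈ p ⁻¹' {x} := fun y hy => (hfin x).mem_toFinset.1 hy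
  -- Partition into sheets: over `U`, `f` is the sum of its values along the sections times the
  -- indicators of the sheets. One factor `b` cuts off the section, the other the indicator. Thus,
  -- near `x`, the functionals are generated by the finitely many `ev y`.
  have hdecomp : ∀ f : C(Y, ℂ), (b * b).comp p * f = ∑ y ∈ F, (ev y f).comp p * e y := by
    intro f
    ext w
    rw [ContinuousMap.sum_apply]
    simp only [ContinuousMap.mul_apply, ContinuousMap.comp_apply]
    by_cases hw : p w ∈ U
    · obtain ⟨y, hy, hyw⟩ := hsurj w hw
      have hwV : w ∈ V y := by
        have := ((hs y hy).2.2 (p w) hw).2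
        rwa [hyw] at this
      rw [Finset.sum_eq_single_of_mem y ((hfin x).mem_toFinset.2 hy)]
      · rw [hev y hy, he y hy, hyw, if_pos hwV]
        ring
      · intro y' hy' hne
        rw [he y' (hF y' hy'),
          if_neg fun hv' => Set.disjoint_left.1 (hd hy (hF y' hy') hne.symm) hwV hv']
        ring
    · rw [Finset.sum_eq_zero, hb0 _ hw]
      · ring
      · intro y hy
        rw [he y (hF y hy), hb0 _ hw]
        ring
  have hG : ∀ G : boundedFunctional p, (b * b) • G = ∑ y ∈ F, G (e y) • ev y := by
    intro G
    ext1 f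
    rw [smul_apply, sum_apply, ← map_mul, hdecomp, map_sum]
    refine Finset.sum_congr rfl fun y _ => ?_
    rw [map_mul, smul_apply, mul_comm]
  refine ⟨∑ y ∈ F, (ContinuousMap.const X (Θ (ev y) x)).comp p * e y, fun G => ?_⟩
  have h1 := congrArg (fun G => Θ G x) (hG G)
  simp only [_root_.map_smul, _root_.map_sum, smul_eq_mul, ContinuousMap.mul_apply, hb1,
    ContinuousMap.sum_apply, one_mul] at h1
  rw [h1, map_sum, ContinuousMap.sum_apply]
  refine Finset.sum_congr rfl fun y _ => ?_
  rw [map_mul, ContinuousMap.mul_apply, ContinuousMap.const_apply, mul_comm]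

/-- Differences of the values at two points of a fibre, cut off to small neighbourhoods. -/
theorem exists_difference_functional [T2Space X] [T2Space Y] (ho : IsOpenMap p)
    (hfin : ∀ x, (p ⁻¹' {x}).Finite) {x : X}
    (hx : ∀ᶠ z in 𝓝 x, (p ⁻¹' {z}).ncard = (p ⁻¹' {x}).ncard) {y y' : Y} (hy : p y = x)
    (hy' : p y' = x) {W : Set Y} (hW : W ∈ 𝓝 y) (hW' : W ∈ 𝓝 y') {O : Set X} (hO : O ∈ 𝓝 x) :
    ∃ G : boundedFunctional p, (∀ f, ∀ z ∉ O, G f z = 0) ∧ (∀ f, G f x = f y - f y') ∧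
      ∀ f : C(Y, ℂ), ∀ δ, 0 ≤ δ → (∀ v ∈ W, ∀ w ∈ W, ‖f v - f w‖ ≤ δ) → ‖G f‖ ≤ δ := by
  obtain ⟨U, V, s, hU, hxU, -, -, hs, -⟩ := ho.exists_local_sections hfin hx
  have hcont : ∀ v, p v = x → W ∈ 𝓝 v → s v ⁻¹' W ∈ 𝓝 x := fun v hv hWv => by
    have := (hs v hv).1.continuousAt (hU.mem_nhds hxU)
    rw [ContinuousAt, (hs v hv).2.1] at this
    exact this hWv
  obtain ⟨b, hb1, hb0, hb⟩ := ContinuousMap.exists_bump (inter_mem (hU.mem_nhds hxU)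
    (inter_mem hO (inter_mem (hcont y hy hW) (hcont y' hy' hW'))))
  have hbU : ∀ z ∉ U, b z = 0 := fun z hz => hb0 z fun h => hz h.1
  obtain ⟨G, hG⟩ := exists_section_functional hU hbU (hs y hy).1 fun z hz =>
    ((hs y hy).2.2 z hz).1
  obtain ⟨H, hH⟩ := exists_section_functional hU hbU (hs y' hy').1 fun z hz =>
    ((hs y' hy').2.2 z hz).1
  have hGH : ∀ f z, (G - H) f z = b z * (f (s y z) - f (s y' z)) := by
    intro f z
    rw [mul_sub, ← hG, ← hH]
    rfl
  refine ⟨G - H, fun f z hz => ?_, fun f => ?_, fun f δ hδ h => ?_⟩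
  · rw [hGH, hb0 z fun h => hz h.2.1, zero_mul]
  · rw [hGH, hb1, one_mul, (hs y hy).2.1, (hs y' hy').2.1]
  · refine (ContinuousMap.norm_le _ hδ).2 fun z => ?_
    rw [hGH, norm_mul]
    by_cases hz : z ∈ U ∩ (O ∩ (s y ⁻¹' W ∩ s y' ⁻¹' W))
    · calc _ ≤ 1 * δ := mul_le_mul (hb z) (h _ hz.2.2.1 _ hz.2.2.2) (norm_nonneg _) zero_le_one
        _ = δ := one_mul δ
    · rw [hb0 z hz, norm_zero, zero_mul]
      exact hδ

/-- A sequence of functionals with disjoint supports that tends to zero pointwise can be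
summed. -/
theorem exists_sum_of_disjoint {O : ℕ → Set X} (hO : Pairwise fun i j => Disjoint (O i) (O j))
    (G : ℕ → boundedFunctional p) (hG : ∀ n f, ∀ z ∉ O n, G n f z = 0) {C : ℝ}
    (hC : ∀ n f, ‖G n f‖ ≤ C * ‖f‖) (hlim : ∀ f, Tendsto (fun n => G n f) atTop (𝓝 0)) :
    ∃ H : boundedFunctional p, (∀ n f, ∀ z ∈ O n, H f z = G n f z) ∧
      ∀ f z, (∀ n, z ∉ O n) → H f z = 0 := by
  have hzero : ∀ {n m f z}, z ∈ O n → m ≠ n → G m f z = 0 := fun {n m f z} hz hne =>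
    hG m f z fun hz' => Set.disjoint_left.1 (hO hne) hz' hz
  -- The uniform norm of a sum of functions with disjoint supports is controlled by the largest
  -- norm, so tending to zero suffices for summability.
  have hsum : ∀ f : C(Y, ℂ), Summable fun n => G n f := by
    intro f
    rw [summable_iff_vanishing_norm]
    intro ε hε
    have hev : ∀ᶠ n in atTop, ‖G n f‖ < ε / 2 := by
      have := (hlim f).norm
      rw [norm_zero] at this
      exact this.eventually (gt_mem_nhds (half_pos hε))
    obtain ⟨n₀, hn₀⟩ := eventually_atTop.1 hev
    refine ⟨Finset.range n₀, fun T hT => ?_⟩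
    refine lt_of_le_of_lt ((ContinuousMap.norm_le _ (half_pos hε).le).2 fun z => ?_)
      (half_lt_self hε)
    rw [ContinuousMap.sum_apply]
    by_cases hz : ∃ n ∈ T, z ∈ O n
    · obtain ⟨n, hnT, hz⟩ := hz
      rw [Finset.sum_eq_single_of_mem n hnT fun m _ hne => hzero hz hne]
      have hn : n₀ ≤ n := by
        by_contra hlt
        exact Finset.disjoint_left.1 hT hnT (Finset.mem_range.2 (not_le.1 hlt))
      exact ((G n f).norm_coe_le_norm z).trans (hn₀ n hn).le
    · push Not at hz
      rw [Finset.sum_eq_zero fun n hn => hG n f z (hz n hn), norm_zero]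
      exact (half_pos hε).le
  have hval : ∀ n f, ∀ z ∈ O n, (∑' n, G n f) z = G n f z := by
    intro n f z hz
    rw [← ContinuousMap.tsum_apply (hsum f), tsum_eq_single n fun m hne => hzero hz hne]
  have hval0 : ∀ f z, (∀ n, z ∉ O n) → (∑' n, G n f) z = 0 := by
    intro f z hz
    rw [← ContinuousMap.tsum_apply (hsum f)]
    simp [fun n => hG n f z (hz n)]
  refine ⟨mk (fun f => ∑' n, G n f) (fun f g => ?_) (fun ξ f => ?_) |C| (fun f => ?_), hval, hval0⟩
  · rw [← (hsum f).tsum_add (hsum g)]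
    simp_rw [map_add]
  · simp_rw [map_mul]
    exact (hsum f).tsum_mul_left ξ
  · refine (ContinuousMap.norm_le _ (by positivity)).2 fun z => ?_
    by_cases hz : ∃ n, z ∈ O n
    · obtain ⟨n, hz⟩ := hz
      rw [hval n f z hz]
      exact ((G n f).norm_coe_le_norm z).trans ((hC n f).trans
        (mul_le_mul_of_nonneg_right (le_abs_self C) (norm_nonneg f)))
    · push Not at hz
      rw [hval0 f z hz, norm_zero]
      positivity

end boundedFunctional

end BoundedFunctional

/-! ### Linear maps on the functionals are evaluations -/

section Evaluation

/-- A sequence of points that converges fast to `x₀`, with pairwise disjoint balls around them. -/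
theorem exists_seq_disjoint_balls {X ι : Type*} [MetricSpace X] (q : ι → X) (x₀ : X)
    {P : ℕ → ι → Prop} (h : ∀ n, ∀ r > 0, ∃ i, P n i ∧ 0 < dist (q i) x₀ ∧ dist (q i) x₀ < r) :
    ∃ i : ℕ → ι, (∀ n, P n (i n)) ∧ (∀ n, 0 < dist (q (i n)) x₀) ∧
      Tendsto (fun n => q (i n)) atTop (𝓝 x₀) ∧
      Pairwise fun m n => Disjoint (Metric.ball (q (i m)) (dist (q (i m)) x₀ / 4))
        (Metric.ball (q (i n)) (dist (q (i n)) x₀ / 4)) := by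
  have h' : ∀ n r, ∃ i, 0 < r → P n i ∧ 0 < dist (q i) x₀ ∧ dist (q i) x₀ < r := by
    intro n r
    by_cases hr : 0 < r
    · obtain ⟨i, hi⟩ := h n r hr
      exact ⟨i, fun _ => hi⟩
    · obtain ⟨i, -⟩ := h n 1 one_pos
      exact ⟨i, fun hr' => (hr hr').elim⟩
  choose g hg using h'
  -- Each new point is less than half as far from `x₀` as the previous one. If two of the balls met,
  -- with distances `d'` and `d` of their centres from `x₀` and `d' < d / 2`, then `d < d / 4 + d' /
  -- 4 + d' < 7 * d / 8`.
  let r : ℕ → ℝ := fun n => Nat.rec 1 (fun n r => dist (q (g n r)) x₀ / 2) n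
  have hr_succ : ∀ n, r (n + 1) = dist (q (g n (r n))) x₀ / 2 := fun n => rfl
  have hr : ∀ n, 0 < r n := by
    intro n
    induction n with
    | zero => exact one_pos
    | succ n ih => rw [hr_succ]; exact half_pos (hg n _ ih).2.1
  have hlt : ∀ n, dist (q (g n (r n))) x₀ < r n := fun n => (hg n _ (hr n)).2.2
  have hle : ∀ n, r (n + 1) ≤ r n / 2 := fun n => by
    rw [hr_succ]; linarith [hlt n]
  have hanti : Antitone r := antitone_nat_of_succ_le fun n => by linarith [hle n, hr n]
  have hpow : ∀ n, r n ≤ (1 / 2) ^ n := by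
    intro n
    induction n with
    | zero => simp [r]
    | succ n ih => rw [pow_succ]; linarith [hle n]
  have hdisj : ∀ m n, m < n → Disjoint
      (Metric.ball (q (g m (r m))) (dist (q (g m (r m))) x₀ / 4))
      (Metric.ball (q (g n (r n))) (dist (q (g n (r n))) x₀ / 4)) := by
    intro m n hmn
    rw [Set.disjoint_left]
    intro t ht ht'
    rw [Metric.mem_ball] at ht ht'
    have h1 : dist (q (g n (r n))) x₀ < dist (q (g m (r m))) x₀ / 2 := by
      rw [← hr_succ]
      exact (hlt n).trans_le (hanti hmn)
    have h2 := dist_triangle_left (q (g m (r m))) x₀ t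
    have h3 := dist_triangle t (q (g n (r n))) x₀
    have h4 := (hg m _ (hr m)).2.1
    linarith
  refine ⟨fun n => g n (r n), fun n => (hg n _ (hr n)).1, fun n => (hg n _ (hr n)).2.1, ?_, ?_⟩
  · rw [tendsto_iff_dist_tendsto_zero]
    exact squeeze_zero (fun _ => dist_nonneg) (fun n => ((hlt n).le.trans (hpow n)))
      (tendsto_pow_atTop_nhds_zero_of_lt_one (by norm_num) (by norm_num))
  · intro m n hmn
    rcases lt_or_gt_of_ne hmn with h | h
    · exact hdisj m n h
    · exact (hdisj n m h).symm

variable {X Y : Type*} [MetricSpace X] [CompactSpace X]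
  [TopologicalSpace Y] [CompactSpace Y] [T2Space Y] {p : C(Y, X)}

namespace boundedFunctional

/-- If a `C(X)`-linear map on the functionals is given over regular points by a function `h`,
then the values of `h` at nearby points of the same fibre are close. -/
theorem exists_nhds_norm_sub_lt (ho : IsOpenMap p) (hfin : ∀ x, (p ⁻¹' {x}).Finite)
    (Θ : boundedFunctional p →ₗ[C(X, ℂ)] C(X, ℂ)) {R : Set X}
    (hR : ∀ x ∈ R, ∀ᶠ z in 𝓝 x, (p ⁻¹' {z}).ncard = (p ⁻¹' {x}).ncard) {h : Y → ℂ}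
    (hh : ∀ x ∈ R, ∃ m : C(Y, ℂ), (∀ G, Θ G x = G m x) ∧ ∀ y, p y = x → h y = m y)
    (y₀ : Y) {ε : ℝ} (hε : 0 < ε) :
    ∃ W ∈ 𝓝 y₀, ∀ y ∈ W, ∀ y' ∈ W, p y = p y' → p y ∈ R → ‖h y - h y'‖ < ε := by
  by_contra! hcon
  obtain ⟨V, V', hV, hV', hyV, hd, hsub⟩ := (hfin (p y₀)).exists_isOpen_disjoint y₀
  have hbasis := p.continuous.isClosedMap.nhds_eq_comap_inf_principal p.continuous hV hV' hyV hd
    hsub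
  -- Countable bases at the points of `Y` are inherited from the metric on `X`, so a sequence of bad
  -- pairs can be chosen.
  have hcg : (𝓝 y₀).IsCountablyGenerated := by rw [hbasis]; infer_instance
  obtain ⟨W, hW⟩ := (𝓝 y₀).exists_antitone_basis
  have hstep : ∀ n, ∀ r > 0, ∃ i : Y × Y, (i.1 ∈ interior (W n) ∧ i.2 ∈ interior (W n) ∧
      p i.1 = p i.2 ∧ p i.1 ∈ R ∧ ε ≤ ‖h i.1 - h i.2‖) ∧
      0 < dist (p i.1) (p y₀) ∧ dist (p i.1) (p y₀) < r := by
    intro n r hr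
    obtain ⟨y, hy, y', hy', hpy, hyR, hle⟩ := hcon (interior (W n) ∩ (V ∩
      p ⁻¹' Metric.ball (p y₀) r)) (inter_mem (interior_mem_nhds.2 (hW.1.mem_of_mem trivial))
        (inter_mem (hV.mem_nhds hyV) (p.continuous.continuousAt.preimage_mem_nhds
          (Metric.ball_mem_nhds _ hr))))
    refine ⟨(y, y'), ⟨hy.1, hy'.1, hpy, hyR, hle⟩, dist_pos.2 fun heq => ?_, hy.2.2⟩
    -- Over `p y₀` itself a bad pair inside `V` would consist of `y₀` twice; hence bad pairs lie
    -- over points different from `p y₀`.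
    have huniq : ∀ v ∈ V, p v = p y₀ → v = y₀ := by
      intro v hv hpv
      rcases hsub (show v ∈ p ⁻¹' {p y₀} from hpv) with h | h
      · exact h
      · exact (Set.disjoint_left.1 hd hv h).elim
    have h1 := huniq y hy.2.1 heq
    have h2 := huniq y' hy'.2.1 (hpy.symm.trans heq)
    rw [h1, h2, sub_self, norm_zero] at hle
    exact hle.not_gt hε
  obtain ⟨i, hi, hpos, hlim, hdisj⟩ := exists_seq_disjoint_balls (fun i : Y × Y => p i.1) (p y₀)
    hstep
  set O : ℕ → Set X := fun n => Metric.ball (p (i n).1) (dist (p (i n).1) (p y₀) / 4) with hO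
  have hcenter : ∀ n, p (i n).1 ∈ O n := fun n =>
    Metric.mem_ball_self (div_pos (hpos n) four_pos)
  have hG : ∀ n, ∃ G : boundedFunctional p, (∀ f, ∀ z ∉ O n, G f z = 0) ∧
      (∀ f, G f (p (i n).1) = f (i n).1 - f (i n).2) ∧ ∀ f : C(Y, ℂ), ∀ δ, 0 ≤ δ →
        (∀ v ∈ W n, ∀ w ∈ W n, ‖f v - f w‖ ≤ δ) → ‖G f‖ ≤ δ := fun n =>
    exists_difference_functional ho hfin (hR _ (hi n).2.2.2.1) rfl (hi n).2.2.1.symm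
      (mem_interior_iff_mem_nhds.1 (hi n).1) (mem_interior_iff_mem_nhds.1 (hi n).2.1)
      (Metric.isOpen_ball.mem_nhds (hcenter n))
  choose G hG0 hGx hGδ using hG
  have hGlim : ∀ f, Tendsto (fun n => G n f) atTop (𝓝 0) := by
    intro f
    rw [Metric.tendsto_atTop]
    intro δ hδ
    have hnhds : {v | ‖f v - f y₀‖ < δ / 4} ∈ 𝓝 y₀ := by
      have hc : ContinuousAt (fun v => ‖f v - f y₀‖) y₀ := by fun_prop
      refine hc.eventually (gt_mem_nhds ?_)
      simpa using hδ
    obtain ⟨n₀, -, hn₀⟩ := hW.1.mem_iff.1 hnhds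
    refine ⟨n₀, fun n hn => ?_⟩
    rw [dist_zero_right]
    refine lt_of_le_of_lt (hGδ n f (δ / 2) (half_pos hδ).le fun v hv w hw => ?_) (half_lt_self hδ)
    have h1 : ‖f v - f y₀‖ < δ / 4 := hn₀ (hW.2 hn hv)
    have h2 : ‖f w - f y₀‖ < δ / 4 := hn₀ (hW.2 hn hw)
    have h3 := norm_sub_le (f v - f y₀) (f w - f y₀)
    rw [sub_sub_sub_cancel_right] at h3
    linarith
  -- Gliding hump: only the even differences are summed. The continuous function `Θ H` then has
  -- modulus at least `ε` at the even base points and vanishes at the odd ones, although both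
  -- sequences converge to `p y₀`.
  obtain ⟨H, hH, hH0⟩ := exists_sum_of_disjoint (O := fun k => O (2 * k))
    (fun k l hkl => hdisj (by omega)) (fun k => G (2 * k)) (fun k => hG0 (2 * k)) (C := 2)
    (fun k f => hGδ _ f _ (by positivity) fun v _ w _ => by
      refine (norm_sub_le _ _).trans ?_
      linarith [f.norm_coe_le_norm v, f.norm_coe_le_norm w])
    (fun f => (hGlim f).comp (tendsto_id.const_mul_atTop' two_pos))
  have hΘ : Tendsto (fun n => Θ H (p (i n).1)) atTop (𝓝 (Θ H (p y₀))) :=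
    ((Θ H).continuous.tendsto _).comp hlim
  have heven : ∀ k, ε ≤ ‖Θ H (p (i (2 * k)).1)‖ := by
    intro k
    obtain ⟨m, hm, hmh⟩ := hh _ (hi (2 * k)).2.2.2.1
    rw [hm, hH k m _ (hcenter _), hGx, ← hmh _ rfl, ← hmh _ (hi (2 * k)).2.2.1.symm]
    exact (hi (2 * k)).2.2.2.2
  have hodd : ∀ k, Θ H (p (i (2 * k + 1)).1) = 0 := by
    intro k
    obtain ⟨m, hm, -⟩ := hh _ (hi (2 * k + 1)).2.2.2.1
    rw [hm]
    exact hH0 m _ fun l hl => Set.disjoint_left.1 (hdisj (by omega : 2 * l ≠ 2 * k + 1)) hl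
      (hcenter _)
  have h0 : Θ H (p y₀) = 0 := by
    refine tendsto_nhds_unique (hΘ.comp (tendsto_atTop_mono (fun k => ?_) tendsto_id :
      Tendsto (fun k => 2 * k + 1) atTop atTop)) ?_
    · show k ≤ 2 * k + 1
      omega
    · simp only [Function.comp_def, hodd]
      exact tendsto_const_nhds
  have h1 : ε ≤ ‖Θ H (p y₀)‖ :=
    ge_of_tendsto' ((hΘ.comp (tendsto_id.const_mul_atTop' two_pos :
      Tendsto (fun k => 2 * k) atTop atTop)).norm) heven
  rw [h0, norm_zero] at h1
  exact h1.not_gt hε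

omit [T2Space Y] in
/-- Averages with a continuous density. -/
theorem exists_average_functional {F : X → Finset Y} (hF : ∀ x y, y ∈ F x ↔ p y = x) {μ : Y → ℝ}
    (hμ : ∀ y, 0 ≤ μ y) (hμ1 : ∀ x, ∑ y ∈ F x, μ y = 1)
    (hE : ∀ f : C(Y, ℂ), Continuous fun x => ∑ y ∈ F x, (μ y : ℂ) * f y) (σ : C(Y, ℂ)) :
    ∃ G : boundedFunctional p, ∀ f x, G f x = ∑ y ∈ F x, (μ y : ℂ) * (σ y * f y) := by
  refine ⟨mk (fun f => ⟨_, hE (σ * f)⟩) (fun f g => ?_) (fun ξ f => ?_) ‖σ‖ (fun f => ?_),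
    fun f x => rfl⟩
  · ext x
    simp [mul_add, Finset.sum_add_distrib]
  · ext x
    simp only [ContinuousMap.coe_mk, ContinuousMap.mul_apply, ContinuousMap.comp_apply]
    rw [Finset.mul_sum]
    exact Finset.sum_congr rfl fun y hy => by rw [(hF x y).1 hy]; ring
  · refine (ContinuousMap.norm_le _ (by positivity)).2 fun x => ?_
    rw [ContinuousMap.coe_mk]
    calc _ ≤ ∑ y ∈ F x, ‖(μ y : ℂ) * (σ * f) y‖ := norm_sum_le _ _
      _ ≤ ∑ y ∈ F x, μ y * (‖σ‖ * ‖f‖) := by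
        refine Finset.sum_le_sum fun y _ => ?_
        rw [norm_mul, Complex.norm_real, Real.norm_of_nonneg (hμ y)]
        exact mul_le_mul_of_nonneg_left (((σ * f).norm_coe_le_norm y).trans (norm_mul_le _ _))
          (hμ y)
      _ = ‖σ‖ * ‖f‖ := by rw [← Finset.sum_mul, hμ1, one_mul]

/-- If a `C(X)`-linear map on the functionals is given over regular points by a function `h`,
then `h` has limits at all points of `Y`. -/
theorem exists_tendsto (ho : IsOpenMap p) {F : X → Finset Y} (hF : ∀ x y, y ∈ F x ↔ p y = x)
    {μ : Y → ℝ} (hμ : ∀ y, 0 < μ y) (hμ1 : ∀ x, ∑ y ∈ F x, μ y = 1)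
    (hE : ∀ f : C(Y, ℂ), Continuous fun x => ∑ y ∈ F x, (μ y : ℂ) * f y)
    (Θ : boundedFunctional p →ₗ[C(X, ℂ)] C(X, ℂ)) {R : Set X}
    (hR : ∀ x ∈ R, ∀ᶠ z in 𝓝 x, (p ⁻¹' {z}).ncard = (p ⁻¹' {x}).ncard) {h : Y → ℂ}
    (hh : ∀ x ∈ R, ∃ m : C(Y, ℂ), (∀ G, Θ G x = G m x) ∧ ∀ y, p y = x → h y = m y) (y₀ : Y) :
    ∃ l, Tendsto h (𝓝[p ⁻¹' R] y₀) (𝓝 l) := by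
  have hfin : ∀ x, (p ⁻¹' {x}).Finite := fun x => by
    have : p ⁻¹' {x} = F x := by ext y; simp [hF]
    rw [this]
    exact (F x).finite_toSet
  obtain ⟨V, V', hV, hV', hyV, hd, hsub⟩ := (hfin (p y₀)).exists_isOpen_disjoint y₀
  have hbasis := p.continuous.isClosedMap.nhds_eq_comap_inf_principal p.continuous hV hV' hyV hd
    hsub
  obtain ⟨σ, hσ1, hσ0, hσ⟩ := ContinuousMap.exists_bump (hV.mem_nhds hyV)
  obtain ⟨G, hG⟩ := exists_average_functional hF (fun y => (hμ y).le) hμ1 hE σ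
  set S : C(X, ℂ) := G 1 with hSdef
  have hS : ∀ x, S x = ∑ y ∈ F x, (μ y : ℂ) * σ y := fun x => by
    rw [hSdef, hG]
    exact Finset.sum_congr rfl fun y _ => by rw [ContinuousMap.one_apply, mul_one]
  -- Since `V` contains no other point of this fibre, the sum reduces to `μ y₀`, which is positive.
  have hS0 : S (p y₀) ≠ 0 := by
    rw [hS, Finset.sum_eq_single_of_mem y₀ ((hF _ _).2 rfl), hσ1, mul_one]
    · exact_mod_cast (hμ y₀).ne'
    · intro y hy hne
      rw [hσ0 y, mul_zero]
      intro hyV'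
      rcases hsub (show y ∈ p ⁻¹' {p y₀} from (hF _ _).1 hy) with h | h
      · exact hne h
      · exact Set.disjoint_left.1 hd hyV' h
  have hK : ∀ x ∈ R, Θ G x = ∑ y ∈ F x, (μ y : ℂ) * (σ y * h y) := by
    intro x hx
    obtain ⟨m, hm, hmh⟩ := hh x hx
    rw [hm, hG]
    exact Finset.sum_congr rfl fun y hy => by rw [hmh y ((hF x y).1 hy)]
  -- Only points `z` of the fibre that lie in `V` contribute, and for `y` near `y₀` these are near
  -- `y₀` too, where `h z` is close to `h y`. So `h y` may be taken out of the average up to a small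
  -- error.
  have hdiff : Tendsto (fun y => h y * S (p y) - Θ G (p y)) (𝓝[p ⁻¹' R] y₀) (𝓝 0) := by
    rw [Metric.tendsto_nhds]
    intro ε hε
    obtain ⟨W, hW, hWε⟩ := exists_nhds_norm_sub_lt ho hfin Θ hR hh y₀ (half_pos hε)
    have hW' := hW
    rw [hbasis, mem_inf_principal] at hW'
    obtain ⟨O, hO, hOW⟩ := hW'
    filter_upwards [self_mem_nhdsWithin, mem_nhdsWithin_of_mem_nhds (hV.mem_nhds hyV),
      mem_nhdsWithin_of_mem_nhds (p.continuous.continuousAt.preimage_mem_nhds hO)]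
      with y hyR hyV' hyO
    rw [dist_zero_right, hK _ hyR, hS, Finset.mul_sum, ← Finset.sum_sub_distrib]
    refine lt_of_le_of_lt ?_ (half_lt_self hε)
    calc _ ≤ ∑ z ∈ F (p y), ‖h y * ((μ z : ℂ) * σ z) - (μ z : ℂ) * (σ z * h z)‖ :=
          norm_sum_le _ _
      _ ≤ ∑ z ∈ F (p y), μ z * (ε / 2) := by
        refine Finset.sum_le_sum fun z hz => ?_
        have hpz : p z = p y := (hF _ _).1 hz
        have heq : h y * ((μ z : ℂ) * σ z) - (μ z : ℂ) * (σ z * h z) =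
            (μ z : ℂ) * (σ z * (h y - h z)) := by ring
        rw [heq, norm_mul, Complex.norm_real, Real.norm_of_nonneg (hμ z).le]
        refine mul_le_mul_of_nonneg_left ?_ (hμ z).le
        rw [norm_mul]
        by_cases hzV : z ∈ V
        · have hzW : z ∈ W := hOW (show z ∈ p ⁻¹' O by rw [Set.mem_preimage, hpz]; exact hyO) hzV
          have := hWε y (hOW hyO hyV') z hzW hpz.symm hyR
          calc _ ≤ 1 * (ε / 2) := mul_le_mul (hσ z) this.le (norm_nonneg _) zero_le_one
            _ = ε / 2 := one_mul _
        · rw [hσ0 z hzV, norm_zero, zero_mul]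
          exact (half_pos hε).le
      _ = ε / 2 := by rw [← Finset.sum_mul, hμ1, one_mul]
  have hSlim : Tendsto (fun y => S (p y)) (𝓝[p ⁻¹' R] y₀) (𝓝 (S (p y₀))) :=
    ((S.comp p).continuous.tendsto y₀).mono_left nhdsWithin_le_nhds
  have hKlim : Tendsto (fun y => Θ G (p y)) (𝓝[p ⁻¹' R] y₀) (𝓝 (Θ G (p y₀))) :=
    (((Θ G).comp p).continuous.tendsto y₀).mono_left nhdsWithin_le_nhds
  refine ⟨(0 + Θ G (p y₀)) / S (p y₀), ((hdiff.add hKlim).div hSlim hS0).congr' ?_⟩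
  filter_upwards [hSlim.eventually_ne hS0] with y hy
  rw [Pi.div_apply, sub_add_cancel, mul_div_cancel_right₀ _ hy]

/-- Every `C(X)`-linear map on the functionals is the evaluation at an element of `C(Y)`. -/
theorem exists_eval (ho : IsOpenMap p) {F : X → Finset Y} (hF : ∀ x y, y ∈ F x ↔ p y = x)
    {N : ℕ} (hN : ∀ x, (F x).card ≤ N)
    {μ : Y → ℝ} (hμ : ∀ y, 0 < μ y) (hμ1 : ∀ x, ∑ y ∈ F x, μ y = 1)
    (hE : ∀ f : C(Y, ℂ), Continuous fun x => ∑ y ∈ F x, (μ y : ℂ) * f y)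
    (Θ : boundedFunctional p →ₗ[C(X, ℂ)] C(X, ℂ)) : ∃ m : C(Y, ℂ), ∀ G, Θ G = G m := by
  have hfib : ∀ x, p ⁻¹' {x} = F x := fun x => by ext y; simp [hF]
  have hfin : ∀ x, (p ⁻¹' {x}).Finite := fun x => by
    rw [hfib]
    exact (F x).finite_toSet
  set R : Set X := {x | ∀ᶠ z in 𝓝 x, (p ⁻¹' {z}).ncard = (p ⁻¹' {x}).ncard} with hRdef
  have hRd : Dense R := ho.dense_locally_constant_ncard hfin (N := N) fun x => by
    rw [hfib, Set.ncard_coe_finset]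
    exact hN x
  have hm : ∀ x, ∃ m : C(Y, ℂ), x ∈ R → ∀ G, Θ G x = G m x := by
    intro x
    by_cases hx : x ∈ R
    · obtain ⟨m, hm⟩ := exists_eval_at ho hfin Θ hx
      exact ⟨m, fun _ => hm⟩
    · exact ⟨0, fun h => (hx h).elim⟩
  choose m hm using hm
  set h : Y → ℂ := fun y => m (p y) y with hh
  have hlim := exists_tendsto ho hF hμ hμ1 hE Θ (R := R) (h := h) (fun x hx => hx)
    fun x hx => ⟨m x, hm x hx, fun y hy => by rw [hh, ← hy]⟩
  have hdense : Dense (p ⁻¹' R) := hRd.preimage ho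
  have hext : ∀ y ∈ p ⁻¹' R, extendFrom (p ⁻¹' R) h y = h y := by
    intro y hy
    obtain ⟨l, hl⟩ := hlim y
    rw [extendFrom_eq (hdense y) hl]
    exact tendsto_nhds_unique (hl.mono_left (pure_le_nhdsWithin hy)) (tendsto_pure_nhds h y)
  refine ⟨⟨extendFrom (p ⁻¹' R) h, continuous_extendFrom hdense hlim⟩, fun G => ?_⟩
  refine DFunLike.coe_injective (Continuous.ext_on hRd (Θ G).continuous
    (ContinuousMap.continuous _) fun x hx => ?_)
  -- Over `R` the extension agrees with `m x` on the whole fibre, and a functional at `x` sees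
  -- nothing else.
  rw [hm x hx]
  refine apply_congr G fun y hy => ?_
  change m x y = extendFrom (p ⁻¹' R) h y
  rw [hext y (show p y ∈ R from hy ▸ hx), hh]
  simp only [hy]

end boundedFunctional

end Evaluation

/-! ### Reflexivity -/

section Reflexivity

theorem ModuleDual.norm_le {A M : Type*} [CommCStarAlgebra A] [NormedAddCommGroup M] [Module A M]
    {f : ModuleDual A M} {C : ℝ} (hC : 0 ≤ C) (h : ∀ m, ‖f m‖ ≤ C * ‖m‖) : ‖f‖ ≤ C :=
  csInf_le ⟨0, fun _ hc => hc.1⟩ ⟨hC, h⟩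

/-- The canonical map of a Hilbert module over a commutative C⋆-algebra to its bidual is
isometric. -/
theorem isometry_toBidual (A M : Type*) [CommCStarAlgebra A] [PartialOrder A] [StarOrderedRing A]
    [NormedAddCommGroup M] [Module ℂ M] [Module A M] [CStarModule A M] :
    Isometry (toBidual A M) := by
  rw [AddMonoidHomClass.isometry_iff_norm]
  intro x
  refine le_antisymm (ModuleDual.norm_le (norm_nonneg x) fun f => ?_) ?_
  · change ‖star (f x)‖ ≤ _
    rw [norm_star, mul_comm]
    exact f.norm_apply_le x
  -- The functional `⟨x, ·⟩` has norm at most `‖x‖` and takes at `x` a value of norm `‖x‖ ^ 2`.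
  · let φ : ModuleDual A M := ModuleDual.mk (fun y => inner A x y)
      (fun _ _ => CStarModule.inner_add_right) (fun _ _ => CStarModule.inner_op_smul_right) ‖x‖
      (fun _ => CStarModule.norm_inner_le M)
    have h1 : ‖φ‖ ≤ ‖x‖ := ModuleDual.norm_le (norm_nonneg x) fun y => CStarModule.norm_inner_le M
    have h2 : ‖x‖ ^ 2 = ‖toBidual A M x φ‖ := by
      change _ = ‖star (inner A x x)‖
      rw [norm_star, CStarModule.norm_sq_eq A]
    have h3 := (toBidual A M x).norm_apply_le φ
    rw [← h2, sq] at h3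
    rcases (norm_nonneg x).eq_or_lt with h0 | h0
    · rw [← h0]; exact norm_nonneg _
    · exact le_of_mul_le_mul_right (h3.trans (mul_le_mul_of_nonneg_left h1 (norm_nonneg _))) h0

/-- By equivalence of norms, the dual of the Hilbert module consists of the same maps as
`boundedFunctional p`, but with the conjugate action of `C(X)`. Composing an element `Φ` of the
bidual with `star` makes it `C(X)`-linear for the pointwise action, so `heval` applies. -/
theorem HilbertProduct.surjective_toBidual {X Y : Type*} [TopologicalSpace X] [CompactSpace X]
    [TopologicalSpace Y] [CompactSpace Y] {p : C(Y, X)}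
    (heval : ∀ Θ : boundedFunctional p →ₗ[C(X, ℂ)] C(X, ℂ), ∃ m : C(Y, ℂ), ∀ G, Θ G = G m)
    (B : HilbertProduct p) (hB : B.IsNormEquivalent) :
    Function.Surjective (toBidual C(X, ℂ) B.HilbertModule) := by
  obtain ⟨c, C, hc, hC, hcC⟩ := hB
  have hle : ∀ f : C(Y, ℂ), ‖f‖ ≤ c⁻¹ * ‖B.toModule f‖ := fun f => by
    rw [B.norm_toModule, inv_mul_eq_div, le_div_iff₀ hc, mul_comm]
    exact (hcC f).1
  have hdual : ∀ G : boundedFunctional p, ∃ f : ModuleDual C(X, ℂ) B.HilbertModule,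
      ∀ x, f x = G (B.toModule.symm x) := by
    intro G
    obtain ⟨D, hD⟩ := G.2
    refine ⟨ModuleDual.mk (fun x => G (B.toModule.symm x)) (fun x y => ?_) (fun a x => ?_)
      (|D| * c⁻¹) (fun x => ?_), fun x => rfl⟩
    · rw [map_add, boundedFunctional.map_add]
    · exact boundedFunctional.map_mul G a (B.toModule.symm x)
    · calc _ ≤ D * ‖B.toModule.symm x‖ := hD _
        _ ≤ |D| * ‖B.toModule.symm x‖ :=
          mul_le_mul_of_nonneg_right (le_abs_self D) (norm_nonneg _)
        _ ≤ |D| * (c⁻¹ * ‖x‖) := by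
          refine mul_le_mul_of_nonneg_left ?_ (abs_nonneg D)
          have := hle (B.toModule.symm x)
          rwa [LinearEquiv.apply_symm_apply] at this
        _ = _ := (mul_assoc _ _ _).symm
  choose dual hdual using hdual
  intro Φ
  obtain ⟨m, hm⟩ := heval
    { toFun := fun G => star (Φ (dual G))
      map_add' := fun G H => by
        have : dual (G + H) = dual G + dual H := by
          ext1 x
          rw [ModuleDual.add_apply, hdual, hdual, hdual]
          rfl
        rw [this, ModuleDual.map_add, star_add]
      map_smul' := fun a G => by
        have : dual (a • G) = star a • dual G := by
          ext1 x
          rw [ModuleDual.smul_apply, hdual, hdual, star_star]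
          rfl
        rw [this, ModuleDual.map_smul, star_mul', star_star]
        rfl }
  refine ⟨B.toModule m, ModuleDual.ext fun f => ?_⟩
  let G : boundedFunctional p := boundedFunctional.mk (fun g => f (B.toModule g))
    (fun g h => by rw [map_add, ModuleDual.map_add])
    (fun ξ g => by rw [← B.smul_toModule, ModuleDual.map_smul]) (‖f‖ * C)
    (fun g => by
      refine (f.norm_apply_le _).trans ?_
      rw [mul_assoc, B.norm_toModule]
      exact mul_le_mul_of_nonneg_left (hcC g).2 (norm_nonneg f))
  have hG : dual G = f := by
    ext1 x
    rw [hdual]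
    change f (B.toModule (B.toModule.symm x)) = f x
    rw [LinearEquiv.apply_symm_apply]
  have h1 : star (Φ (dual G)) = f (B.toModule m) := hm G
  change star (f (B.toModule m)) = Φ f
  rw [← h1, star_star, hG]

end Reflexivity

theorem mainTheorem5 {X Y : Type*} [MetricSpace X] [CompactSpace X]
    [TopologicalSpace Y] [CompactSpace Y] [T2Space Y]
    (p : C(Y, X)) (hp : IsBranchedCovering p) :
    (∃ B : HilbertProduct p, B.IsNormEquivalent ∧ B.IsFiberAverage) ∧
      ∀ B : HilbertProduct p, B.IsNormEquivalent →
        IsReflexiveModule C(X, ℂ) B.HilbertModule := by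
  obtain ⟨F, N, hF, hN⟩ := hp.exists_finset_fibers
  obtain ⟨μ, c, hc, hμ, hμ1, hE⟩ := hp.isOpenMap.exists_fiber_weight hp.surjective hF hN
  refine ⟨⟨fiberHilbertProduct hE hF hc hμ hμ1, ⟨√c, 1, Real.sqrt_pos.2 hc, one_pos, fun f =>
    ⟨sqrt_mul_norm_le_fiberInner hE hF hc hμ f, fiberInner_le_norm hE hc hμ hμ1 f⟩⟩,
    μ, fun y => hc.trans_le (hμ y), fun x => ?_, fun f g x => ?_⟩, fun B hB => ?_⟩
  · rw [finsum_mem_eq_sum_of_fiber hF]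
    exact hμ1 x
  · rw [finsum_mem_eq_sum_of_fiber hF]
    exact fiberInner_apply F μ hE f g x
  · have hiso := isometry_toBidual C(X, ℂ) B.HilbertModule
    exact ⟨⟨hiso.injective, B.surjective_toBidual (boundedFunctional.exists_eval hp.isOpenMap hF hN
      (fun y => hc.trans_le (hμ y)) hμ1 hE) hB⟩, hiso⟩
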